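/- Let $K$ be a number field of degree $d$ over $\mathbb{Q}$, embedded in an algebraic closure $\overline{\mathbb{Q}}$ of $\mathbb{Q}$. Heights. Let $L$ be a number field. For a place $v$ of $L$ let $d_v=[L_v:\mathbb{Q}_v]$ be the local degree and let $\|\cdot\|_v$ be the absolute value on $L_v$ extending the usual absolute value of $\mathbb{R}$ or $\mathbb{C}$ if $v\mid\infty$, or the usual $p$-adic absolute value if $v\mid p$. For a finite-dimensional vector $\boldsymbol{x}=(x_1,\dots,x_n)$ with coordinates in $L$ put $$H_v(\boldsymbol{x})=\max_{1\le i\le n}\|x_i\|_v^{d_v/[L:\mathbb{Q}]}\ \ (v\nmid\infty),\qquad H_v(\boldsymbol{x})=\Bigl(\sum_{i=1}^{n}\|x_i\|_v^2\Bigr)^{d_v/(2[L:\mathbb{Q}])}\ \ (v\mid\infty),$$ and $H(\boldsymbol{x})=\prod_v H_v(\boldsymbol{x})$, the product being over all places $v$ of $L$. The value does not depend on the choice of the number field $L$ containing the coordinates, so $H$ is defined on vectors over $\overline{\mathbb{Q}}$. The height $H(F)$ of a polynomial $F$ over $K$ is the height of its vector of coefficients. For $\boldsymbol{z}\in\overline{\mathbb{Q}}^N$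 write $\deg_K(\boldsymbol{z})=[K(z_1,\dots,z_N):K]$. Proposition. Let $M\ge 1$ and $N\ge 2$ be integers, and let $F(X_1,\dots,X_N)\in K[X_1,\dots,X_N]$ be a (not necessarily homogeneous) polynomial of total degree $M$. If $F$ is not a monomial, that is, not of the form $cX_1^{m_1}\cdots X_N^{m_N}$ with $c\in K$, then there exists $\boldsymbol{z}\in\overline{\mathbb{Q}}^N$ with $\deg_K(\boldsymbol{z})\le M$ such that $F(\boldsymbol{z})=0$, $z_i\neq 0$ for all $1\le i\le N$, and $$H(\boldsymbol{z})\le M^M\sqrt{N-1}\,H(F).$$ -/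

import Mathlib

namespace PolyZeros

/-- The local height at an infinite place `v` of a number field `K` of degree `d`:
`(∑ i, ‖x i‖_v ^ 2) ^ (d_v / (2 d))`. Here `v (x i)` is the absolute value extending the usual
one on `ℝ` or `ℂ`, and the local degree `d_v` is `v.mult`. -/
noncomputable def infiniteLocalHeight {K : Type*} [Field K] [NumberField K]
    (v : NumberField.InfinitePlace K) {ι : Type*} [Fintype ι] (x : ι → K) : ℝ :=
  (∑ i, v (x i) ^ 2) ^ ((v.mult : ℝ) / (2 * (Module.finrank ℚ K : ℝ)))

/-- The local height at a finite place `v` of a number field `K` of degree `d`: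
`max_i |x i|_v` with `|a|_v = ‖a‖_v ^ (d_v / d)`, where `‖·‖_v` extends the usual `p`-adic absolute
value. Mathlib's `v a` is normalized by the absolute norm of the prime ideal of `v`, that is,
`v a = ‖a‖_v ^ d_v`; hence `|a|_v = v a ^ (1 / d)`. -/
noncomputable def finiteLocalHeight {K : Type*} [Field K] [NumberField K]
    (v : NumberField.FinitePlace K) {ι : Type*} [Fintype ι] (x : ι → K) : ℝ :=
  ⨆ i, v (x i) ^ (1 / (Module.finrank ℚ K : ℝ))

/-- The height `H` of a vector with coordinates in a number field `K`: the product of the local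
heights over all places of `K`. For `x ≠ 0` all but finitely many factors are `1`. -/
noncomputable def height {K : Type*} [Field K] [NumberField K]
    {ι : Type*} [Fintype ι] (x : ι → K) : ℝ :=
  (∏ v : NumberField.InfinitePlace K, infiniteLocalHeight v x) *
    ∏ᶠ v : NumberField.FinitePlace K, finiteLocalHeight v x

/-- The height of a polynomial over a number field: the height of its vector of coefficients
(zero coefficients do not change the height, so they are left out). -/
noncomputable def polyHeight {K : Type*} [Field K] [NumberField K] {σ : Type*}
    (F : MvPolynomial σ K) : ℝ :=
  height (fun m : F.support => F.coeff m)

/-- The field `ℚ(x_1, …, x_n)` generated by the coordinates of a vector of algebraic numbers. -/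
noncomputable abbrev coordField {ι : Type*} (x : ι → AlgebraicClosure ℚ) :
    IntermediateField ℚ (AlgebraicClosure ℚ) :=
  IntermediateField.adjoin ℚ (Set.range x)

theorem coordField_numberField {ι : Type*} [Fintype ι] (x : ι → AlgebraicClosure ℚ) :
    NumberField (coordField x) where
  to_charZero := inferInstance
  to_finiteDimensional := by
    have : Finite (Set.range x) := Set.finite_range x
    refine IntermediateField.finiteDimensional_adjoin fun y _ => ?_
    have h := ((AlgebraicClosure.isAlgebraic ℚ).isAlgebraic y).isIntegral
    convert h
    exact Subsingleton.elim _ _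

/-- The height `H` of a vector of algebraic numbers, evaluated over the number field generated by
its coordinates. (By the normalization, any number field containing them gives the same value.) -/
noncomputable def algHeight {ι : Type*} [Fintype ι] (x : ι → AlgebraicClosure ℚ) : ℝ :=
  haveI : NumberField (coordField x) := coordField_numberField x
  height (fun i => (⟨x i, IntermediateField.subset_adjoin ℚ _ (Set.mem_range_self i)⟩ :
    coordField x))

/-- `deg_K(x) = [K(x_1, …, x_n) : K]` for a vector `x` of algebraic numbers. -/
noncomputable def degOver (K : Type*) [Field K] [Algebra K (AlgebraicClosure ℚ)]
    {ι : Type*} (x : ι → AlgebraicClosure ℚ) : ℕ :=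
  Module.finrank K (IntermediateField.adjoin K (Set.range x))

end PolyZeros

/-! Substitute `X_i = a_i t` for `i ∈ J` and `X_i = a_i` for `i ∉ J`, with small nonzero integers
`a_i`. This turns `F` into a univariate `G` of degree at most `M`. If `G` keeps two terms, then `G =
t^l p` with `p(0) ≠ 0` and `m = deg p ≥ 1`, and each root `α` of `p` gives a zero of `F` with
nonzero coordinates in `K(α)`. The height of this zero is at most a weighted height of `α`, with
local factor `√(A + B|α|²)` at infinity, where `A` and `B` are the sums of the `a_i²` outside and
inside `J`. The product of these weighted heights over all roots of `p` is controlled by the Mahler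
measure at infinite places and by Gauss's lemma at finite ones, so the root of least weighted height
satisfies `H(z)^m ≤ rootConst m * √W * H(F)` (`exists_zero_of_specialize`).

It remains to choose `J` and `a`. Small `a` that preserve two terms exist because a nonzero
polynomial cannot vanish on a large enough grid. Surplus factors are absorbed by `H(F) ≥ √T`, `T`
being the number of monomials of `F` (`sqrt_card_support_le_polyHeight`).

If `F` is not homogeneous, take `J` to be everything: `z` is a multiple of `a`, and so has the
height of `a`. If `F` is homogeneous and its monomials differ pairwise by exchanging one variable
for another, a single variable `J = {p}` and signs `a_i = ±1` make `p` linear. Otherwise two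
monomials are further apart and `J` can be chosen with `m ≥ 2`; extracting the `m`-th root then
compensates for the crude bounds once `M ≥ 3`. Degree `2` needs sharper choices of `a`. -/

namespace PolyZeros

open NumberField Polynomial

/-! ### Heights over a fixed number field and under field extension -/

section Unnormalized

variable {K : Type*} [Field K] [NumberField K] {ι : Type*} [Fintype ι]

/-- The height of a vector over `K` without the normalizing exponent `1 / [K : ℚ]`. -/
noncomputable def relHeight (x : ι → K) : ℝ :=
  (∏ v : InfinitePlace K, √(∑ i, v (x i) ^ 2) ^ v.mult) * ∏ᶠ v : FinitePlace K, ⨆ i, v (x i)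

theorem hasFiniteMulSupport_iSup_finitePlace {x : ι → K} (hx : x ≠ 0) :
    (fun v : FinitePlace K => ⨆ i, v (x i)).HasFiniteMulSupport := by
  obtain ⟨i, hi⟩ : ∃ j, x j ≠ 0 := Function.ne_iff.mp hx
  have : Nonempty {j // x j ≠ 0} := ⟨i, hi⟩
  -- Zero coordinates never affect the supremum, while each nonzero one has value `1` at almost all
  -- places.
  suffices (fun v : FinitePlace K => ⨆ i : {j // x j ≠ 0}, v (x i)).HasFiniteMulSupport by
    convert! this with v
    have : Nonempty ι := .intro i
    refine le_antisymm (ciSup_le fun j => ?_)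
      (ciSup_le fun ⟨j, hj⟩ => Finite.le_ciSup_of_le j le_rfl)
    rcases eq_or_ne (x j) 0 with h | h
    · rw [h, map_zero]
      exact Real.iSup_nonneg fun i => apply_nonneg v _
    · exact Finite.le_ciSup_of_le ⟨j, h⟩ le_rfl
  exact .iSup fun j => FinitePlace.hasFiniteMulSupport j.2

theorem finprod_iSup_finitePlace_nonneg {ι : Type*} (x : ι → K) :
    0 ≤ ∏ᶠ v : FinitePlace K, ⨆ i, v (x i) :=
  finprod_nonneg fun v => Real.iSup_nonneg fun _ => apply_nonneg v _

theorem relHeight_nonneg (x : ι → K) : 0 ≤ relHeight x :=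
  mul_nonneg (Finset.prod_nonneg fun _ _ => by positivity) (finprod_iSup_finitePlace_nonneg x)

theorem iSup_rpow_of_nonneg [Nonempty ι] {f : ι → ℝ} (hf : ∀ i, 0 ≤ f i) {r : ℝ} (hr : 0 ≤ r) :
    ⨆ i, f i ^ r = (⨆ i, f i) ^ r := by
  obtain ⟨i, hi⟩ := exists_eq_ciSup_of_finite (f := f)
  refine le_antisymm (ciSup_le fun j => ?_) ?_
  · exact Real.rpow_le_rpow (hf j) (Finite.le_ciSup f j) hr
  · rw [← hi]
    exact Finite.le_ciSup (fun j => f j ^ r) i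

theorem finprod_rpow {α : Type*} {f : α → ℝ} (hf : ∀ a, 0 ≤ f a) (hs : f.HasFiniteMulSupport)
    (r : ℝ) : ∏ᶠ a, f a ^ r = (∏ᶠ a, f a) ^ r := by
  have hs : (Function.mulSupport f).Finite := hs
  have h1 : Function.mulSupport f ⊆ (hs.toFinset : Set α) := fun a ha => by
    rw [Set.Finite.coe_toFinset]
    exact ha
  have h2 : Function.mulSupport (fun a => f a ^ r) ⊆ (hs.toFinset : Set α) := fun a ha => by
    rw [Set.Finite.coe_toFinset]
    exact fun h => ha (by simp only [h, Real.one_rpow])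
  rw [finprod_eq_prod_of_mulSupport_subset _ h1, finprod_eq_prod_of_mulSupport_subset _ h2,
    Real.finsetProd_rpow _ _ fun a _ => hf a]

theorem height_eq_relHeight_rpow {x : ι → K} (hx : x ≠ 0) :
    height x = relHeight x ^ (1 / (Module.finrank ℚ K : ℝ)) := by
  have : Nonempty ι := (Function.ne_iff.mp hx).nonempty
  rw [height, relHeight, Real.mul_rpow (Finset.prod_nonneg fun _ _ => by positivity)
    (finprod_iSup_finitePlace_nonneg x), ← Real.finsetProd_rpow _ _ fun _ _ => by positivity,
    ← finprod_rpow (fun v => Real.iSup_nonneg fun _ => apply_nonneg v _)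
      (hasFiniteMulSupport_iSup_finitePlace hx)]
  congr 1
  · refine Finset.prod_congr rfl fun v _ => ?_
    have h : 0 ≤ ∑ i, v (x i) ^ 2 := by positivity
    rw [infiniteLocalHeight, Real.sqrt_eq_rpow, ← Real.rpow_natCast, ← Real.rpow_mul h,
      ← Real.rpow_mul h]
    congr 1
    field_simp
  · refine finprod_congr fun v => ?_
    rw [finiteLocalHeight, iSup_rpow_of_nonneg (fun i => apply_nonneg v _) (by positivity)]

theorem height_nonneg (x : ι → K) : 0 ≤ height x := by
  refine mul_nonneg (Finset.prod_nonneg fun v _ => ?_) (finprod_nonneg fun v => ?_)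
  · exact Real.rpow_nonneg (by positivity) _
  · exact Real.iSup_nonneg fun i => Real.rpow_nonneg (apply_nonneg v _) _

theorem height_pow_finrank {x : ι → K} (hx : x ≠ 0) :
    height x ^ Module.finrank ℚ K = relHeight x := by
  have : (Module.finrank ℚ K : ℝ) ≠ 0 := by exact_mod_cast Module.finrank_pos.ne'
  rw [height_eq_relHeight_rpow hx, ← Real.rpow_natCast, ← Real.rpow_mul (relHeight_nonneg x),
    one_div_mul_cancel this, Real.rpow_one]

/-- Every local factor scales by the local absolute value of `c`, and these multiply to `1` by the
product formula. -/
theorem relHeight_smul (x : ι → K) {c : K} (hc : c ≠ 0) : relHeight (c • x) = relHeight x := by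
  rcases eq_or_ne x 0 with rfl | hx
  · rw [smul_zero]
  have h1 (v : InfinitePlace K) : √(∑ i, v ((c • x) i) ^ 2) ^ v.mult =
      v c ^ v.mult * √(∑ i, v (x i) ^ 2) ^ v.mult := by
    simp only [Pi.smul_apply, smul_eq_mul, map_mul, mul_pow, ← Finset.mul_sum]
    rw [Real.sqrt_mul (by positivity), Real.sqrt_sq (apply_nonneg v c), mul_pow]
  have h2 (v : FinitePlace K) : ⨆ i, v ((c • x) i) = v c * ⨆ i, v (x i) := by
    simp only [Pi.smul_apply, smul_eq_mul, map_mul]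
    rw [Real.mul_iSup_of_nonneg (apply_nonneg v c)]
  simp only [relHeight, h1, h2, Finset.prod_mul_distrib]
  rw [finprod_mul_distrib (FinitePlace.hasFiniteMulSupport hc)
    (hasFiniteMulSupport_iSup_finitePlace hx), mul_mul_mul_comm, prod_abs_eq_one hc, one_mul]

/-- The multiplicity of a place is the number of embeddings inducing it. Embeddings, unlike places,
extend to `L` in exactly `[L : K]` ways, which makes the behaviour under extension transparent. -/
theorem prod_infinitePlace_eq_prod_embeddings (x : ι → K) :
    ∏ v : InfinitePlace K, √(∑ i, v (x i) ^ 2) ^ v.mult =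
      ∏ σ : K →ₐ[ℚ] ℂ, √(∑ i, ‖σ (x i)‖ ^ 2) := by
  classical
  rw [← Fintype.prod_equiv (RingHom.equivRatAlgHom K ℂ) (fun f => √(∑ i, ‖f (x i)‖ ^ 2)) _
    fun f => by simp [RingHom.equivRatAlgHom_apply],
    ← Finset.prod_fiberwise Finset.univ InfinitePlace.mk]
  refine Finset.prod_congr rfl fun v _ => ?_
  rw [← InfinitePlace.card_filter_mk_eq, ← Finset.prod_const]
  refine Finset.prod_congr rfl fun φ hφ => ?_
  rw [← (Finset.mem_filter.mp hφ).2]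
  rfl

theorem exists_integral_multiple (x : ι → K) :
    ∃ (c : K) (y : ι → 𝓞 K), c ≠ 0 ∧ ∀ i, (y i : K) = c * x i := by
  classical
  obtain ⟨b, hb⟩ := IsLocalization.exist_integer_multiples_of_finite (nonZeroDivisors (𝓞 K)) x
  choose y hy using hb
  refine ⟨algebraMap (𝓞 K) K b, y, ?_, fun i => ?_⟩
  · simp
  · rw [RingOfIntegers.coe_eq_algebraMap, hy i, Algebra.smul_def]

variable {L : Type*} [Field L] [NumberField L] [Algebra K L]

/-- For integral coordinates the finite part is the inverse norm of the ideal they generate, and the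
norm of an extended ideal is the `[L : K]`-th power of the original norm. -/
theorem finprod_iSup_finitePlace_algebraMap (y : ι → 𝓞 K) (hy : y ≠ 0) :
    ∏ᶠ v : FinitePlace L, ⨆ i, v (algebraMap K L (y i)) =
      (∏ᶠ v : FinitePlace K, ⨆ i, v (y i : K)) ^ Module.finrank K L := by
  have hinj := FaithfulSMul.algebraMap_injective (𝓞 K) (𝓞 L)
  have hy' : (fun i => algebraMap (𝓞 K) (𝓞 L) (y i)) ≠ 0 := by
    obtain ⟨i, hi⟩ := Function.ne_iff.mp hy
    exact Function.ne_iff.mpr ⟨i, by simpa using hi⟩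
  have h1 := absNorm_mul_finprod_finitePlace_eq_one hy
  have h2 := absNorm_mul_finprod_finitePlace_eq_one hy'
  have h3 : Ideal.span (Set.range fun i => algebraMap (𝓞 K) (𝓞 L) (y i)) =
      (Ideal.span (Set.range y)).map (algebraMap (𝓞 K) (𝓞 L)) := by
    rw [Ideal.map_span, ← Set.range_comp]
    rfl
  have h4 : Module.finrank (𝓞 K) (𝓞 L) = Module.finrank K L :=
    (IsFractionRing.finrank_eq (𝓞 K) K (𝓞 L) L).symm
  rw [h3, Ideal.absNorm_algebraMap, h4, Nat.cast_pow] at h2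
  have h5 : ∏ᶠ v : FinitePlace L, ⨆ i, v (algebraMap K L (y i)) =
      ∏ᶠ v : FinitePlace L, ⨆ i, v ((algebraMap (𝓞 K) (𝓞 L) (y i) : 𝓞 L) : L) := rfl
  rw [h5, ← mul_right_inj' (left_ne_zero_of_mul_eq_one h2), h2, ← mul_pow, h1, one_pow]

theorem relHeight_algebraMap {x : ι → K} (hx : x ≠ 0) :
    relHeight (fun i => algebraMap K L (x i)) = relHeight x ^ Module.finrank K L := by
  -- By homogeneity denominators can be cleared, which the ideal-norm description of the finite part
  -- requires.
  obtain ⟨c, y, hc, hy⟩ := exists_integral_multiple x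
  have hy0 : y ≠ 0 := by
    rintro rfl
    refine hx (funext fun i => ?_)
    simpa [hc] using (hy i).symm
  have hx' : relHeight x = relHeight (fun i => (y i : K)) := by
    rw [← relHeight_smul x hc]
    congr 1
    exact funext fun i => (hy i).symm
  have hxL : relHeight (fun i => algebraMap K L (x i)) =
      relHeight (fun i => algebraMap K L (y i : K)) := by
    rw [← relHeight_smul _ (show algebraMap K L c ≠ 0 by simpa using hc)]
    congr 1
    exact funext fun i => by simp [hy i]
  rw [hx', hxL, relHeight, relHeight, finprod_iSup_finitePlace_algebraMap y hy0, mul_pow,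
    prod_infinitePlace_eq_prod_embeddings, prod_infinitePlace_eq_prod_embeddings]
  congr 1
  rw [Fintype.prod_equiv (algHomEquivSigma (B := K)) (fun σ : L →ₐ[ℚ] ℂ => _)
    (fun σ => √(∑ i, ‖σ.1 (y i : K)‖ ^ 2)), ← Finset.univ_sigma_univ, Finset.prod_sigma,
    ← Finset.prod_pow]
  · refine Finset.prod_congr rfl fun σ _ => ?_
    let : Algebra K ℂ := σ.toRingHom.toAlgebra
    simp_rw [Finset.prod_const]
    congr
    exact AlgHom.card K L ℂ
  · intro σ
    rfl

theorem height_algebraMap {x : ι → K} (hx : x ≠ 0) :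
    height (fun i => algebraMap K L (x i)) = height x := by
  have hx' : (fun i => algebraMap K L (x i)) ≠ 0 := by
    obtain ⟨i, hi⟩ := Function.ne_iff.mp hx
    exact Function.ne_iff.mpr ⟨i, by simpa using hi⟩
  refine (pow_left_inj₀ (height_nonneg _) (height_nonneg _)
    (Module.finrank_pos (R := ℚ) (M := L)).ne').mp ?_
  rw [height_pow_finrank hx', relHeight_algebraMap hx, ← height_pow_finrank hx, ← pow_mul,
    Module.finrank_mul_finrank]

theorem card_pow_mul_prod_le_sum_pow (f : ι → ℝ) (hf : ∀ i, 0 ≤ f i) :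
    (Fintype.card ι : ℝ) ^ Fintype.card ι * ∏ i, f i ≤ (∑ i, f i) ^ Fintype.card ι := by
  rcases isEmpty_or_nonempty ι with h | h
  · simp
  have hc : (0 : ℝ) < Fintype.card ι := by exact_mod_cast Fintype.card_pos
  have := Real.geom_mean_le_arith_mean Finset.univ (fun _ : ι => (1 : ℝ)) f (by simp)
    (by simpa using Fintype.card_pos) fun i _ => hf i
  simp only [Real.rpow_one, Finset.sum_const, Finset.card_univ, nsmul_eq_mul, mul_one,
    one_mul] at this
  have h0 : 0 ≤ ∏ i, f i := Finset.prod_nonneg fun i _ => hf i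
  have h2 := pow_le_pow_left₀ (by positivity) this (Fintype.card ι)
  rw [← Real.rpow_natCast, ← Real.rpow_mul h0,
    inv_mul_cancel₀ hc.ne', Real.rpow_one, div_pow, le_div_iff₀ (by positivity)] at h2
  linarith

/-- Compare the `T`-th power of each local factor with the product of the coordinates: AM-GM gains a
factor at the infinite places, the maximum suffices at the finite ones, and the product formula
removes the coordinates. -/
theorem sqrt_card_le_height [Nonempty ι] {x : ι → K} (hx : ∀ i, x i ≠ 0) :
    √(Fintype.card ι) ≤ height x := by
  obtain ⟨i₀⟩ := ‹Nonempty ι›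
  have hx0 : x ≠ 0 := Function.ne_iff.mpr ⟨i₀, hx i₀⟩
  set T := Fintype.card ι with hT
  have hTpos : T ≠ 0 := Fintype.card_ne_zero
  have hinf (v : InfinitePlace K) :
      (√T ^ v.mult) ^ T * ∏ i, v (x i) ^ v.mult ≤ (√(∑ i, v (x i) ^ 2) ^ v.mult) ^ T := by
    have h := card_pow_mul_prod_le_sum_pow (fun i => v (x i) ^ 2) fun i => by positivity
    have h2 : √T ^ T * ∏ i, v (x i) ≤ √(∑ i, v (x i) ^ 2) ^ T := by
      refine le_of_sq_le_sq ?_ (by positivity)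
      rw [mul_pow, ← pow_mul, mul_comm T, pow_mul, Real.sq_sqrt (by positivity), ← Finset.prod_pow,
        ← pow_mul, mul_comm T, pow_mul, Real.sq_sqrt (by positivity)]
      exact h
    have h3 := pow_le_pow_left₀ (mul_nonneg (by positivity)
      (Finset.prod_nonneg fun i _ => apply_nonneg v _)) h2 v.mult
    rw [mul_pow, ← Finset.prod_pow] at h3
    rwa [← pow_mul, mul_comm v.mult, pow_mul, ← pow_mul _ v.mult, mul_comm v.mult, pow_mul]
  have hfin (v : FinitePlace K) : ∏ i, v (x i) ≤ (⨆ i, v (x i)) ^ T := by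
    rw [hT, ← Finset.card_univ, ← Finset.prod_const]
    exact Finset.prod_le_prod (fun i _ => apply_nonneg v _)
      fun i _ => Finite.le_ciSup (fun i => v (x i)) i
  have key : (√T ^ Module.finrank ℚ K) ^ T ≤ relHeight x ^ T := by
    calc (√T ^ Module.finrank ℚ K) ^ T
        = (∏ v : InfinitePlace K, (√T ^ v.mult) ^ T) *
          ∏ i, ((∏ v : InfinitePlace K, v (x i) ^ v.mult) * ∏ᶠ v : FinitePlace K, v (x i)) := by
          simp only [prod_abs_eq_one (hx _), Finset.prod_const_one, mul_one]
          rw [Finset.prod_pow, Finset.prod_pow_eq_pow_sum, InfinitePlace.sum_mult_eq]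
      _ = (∏ v : InfinitePlace K, ((√T ^ v.mult) ^ T * ∏ i, v (x i) ^ v.mult)) *
          ∏ᶠ v : FinitePlace K, ∏ i, v (x i) := by
          rw [finprod_prod_comm _ _ fun i _ => FinitePlace.hasFiniteMulSupport (hx i),
            Finset.prod_mul_distrib, Finset.prod_mul_distrib, Finset.prod_comm, mul_assoc]
      _ ≤ (∏ v : InfinitePlace K, (√(∑ i, v (x i) ^ 2) ^ v.mult) ^ T) *
          ∏ᶠ v : FinitePlace K, (⨆ i, v (x i)) ^ T := by
          refine mul_le_mul ?_ ?_ ?_ ?_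
          · exact Finset.prod_le_prod (fun v _ => mul_nonneg (by positivity)
              (Finset.prod_nonneg fun i _ => by positivity)) fun v _ => hinf v
          · refine finprod_le_finprod
              (.prod (fun i => FinitePlace.hasFiniteMulSupport (hx i)) _)
              (fun v => Finset.prod_nonneg fun i _ => apply_nonneg v _)
              ((hasFiniteMulSupport_iSup_finitePlace hx0).pow _) hfin
          · exact finprod_nonneg fun v => Finset.prod_nonneg fun i _ => apply_nonneg v _
          · exact Finset.prod_nonneg fun v _ => by positivity
      _ = relHeight x ^ T := by
          rw [relHeight, mul_pow, Finset.prod_pow,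
            finprod_pow (hasFiniteMulSupport_iSup_finitePlace hx0)]
  have h2 := (pow_le_pow_iff_left₀ (by positivity) (relHeight_nonneg x) hTpos).mp key
  rw [← height_pow_finrank hx0] at h2
  exact (pow_le_pow_iff_left₀ (by positivity) (height_nonneg x)
    (Module.finrank_pos (R := ℚ) (M := K)).ne').mp h2

end Unnormalized

/-- The field generated by the coordinates embeds into `L`, so invariance under extension applies.
Heights of zeros can thus be computed in a field containing all the roots. -/
theorem algHeight_algebraMap {L : Type*} [Field L] [NumberField L]
    [Algebra L (AlgebraicClosure ℚ)] {ι : Type*} [Fintype ι] {z : ι → L} (hz : z ≠ 0) :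
    algHeight (fun i => algebraMap L (AlgebraicClosure ℚ) (z i)) = height z := by
  set y : ι → AlgebraicClosure ℚ := fun i => algebraMap L (AlgebraicClosure ℚ) (z i) with hy
  have : NumberField (coordField y) := coordField_numberField y
  let f : L →ₐ[ℚ] AlgebraicClosure ℚ := (algebraMap L (AlgebraicClosure ℚ)).toRatAlgHom
  have hle : coordField y ≤ f.fieldRange := by
    refine IntermediateField.adjoin_le_iff.mpr ?_
    rintro _ ⟨i, rfl⟩
    exact ⟨z i, rfl⟩
  let e : L ≃ₐ[ℚ] f.fieldRange := AlgEquiv.ofInjectiveField f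
  let g : coordField y →+* L :=
    (e.symm : f.fieldRange →+* L).comp (IntermediateField.inclusion hle : _ →+* f.fieldRange)
  let : Algebra (coordField y) L := g.toAlgebra
  have hg (i : ι) : algebraMap (coordField y) L
      ⟨y i, IntermediateField.subset_adjoin ℚ _ (Set.mem_range_self i)⟩ = z i := by
    change e.symm _ = z i
    rw [AlgEquiv.symm_apply_eq]
    rfl
  have hne : (fun i => (⟨y i, IntermediateField.subset_adjoin ℚ _ (Set.mem_range_self i)⟩ :
      coordField y)) ≠ 0 := by
    obtain ⟨i, hi⟩ := Function.ne_iff.mp hz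
    refine Function.ne_iff.mpr ⟨i, fun h => hi ?_⟩
    rw [← hg i, h]
    simp
  rw [algHeight, ← height_algebraMap (L := L) hne]
  congr 1
  exact funext hg

/-! ### Heights of the roots of a univariate polynomial -/

/-- The constant in the comparison between the heights of the roots of a polynomial of degree `m`
and the height of the polynomial. -/
noncomputable def rootConst (m : ℕ) : ℝ := if m = 1 then 1 else √2 ^ m

theorem rootConst_nonneg (m : ℕ) : 0 ≤ rootConst m := by
  rw [rootConst]
  split_ifs <;> positivity

theorem sqrt_add_le_sqrt_two_mul_max {A B r : ℝ} (hA : 0 < A) (hB : 0 < B) (hr : 0 ≤ r) :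
    √(A + B * r ^ 2) ≤ √2 * max (√A) (√B * r) := by
  rw [Real.sqrt_le_iff]
  refine ⟨by positivity, ?_⟩
  rw [mul_pow, Real.sq_sqrt zero_le_two]
  have h1 : A ≤ max (√A) (√B * r) ^ 2 := by
    rw [← Real.sqrt_le_left (by positivity)]
    exact le_max_left _ _
  have h2 : B * r ^ 2 ≤ max (√A) (√B * r) ^ 2 := by
    have := pow_le_pow_left₀ (by positivity) (le_max_right (√A) (√B * r)) 2
    rwa [mul_pow, Real.sq_sqrt hB.le] at this
  linarith

/-- The left side is the Mahler measure of `P = g ∏ (√A X - √B α_i)`, which is at most the `ℓ²` norm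
of its coefficients (Landau). The weights on the right appear because `P` is a rescaling of the
polynomial with roots `α_i`. -/
theorem norm_mul_prod_max_le {m : ℕ} (g : ℂ) (α : Fin m → ℂ) {A B : ℝ} (hA : 0 < A) (hB : 0 < B) :
    ‖g‖ * ∏ i, max (√A) (√B * ‖α i‖) ≤
      √(∑ k ∈ Finset.range (m + 1),
        ‖(C g * ∏ i, (X - C (α i))).coeff k‖ ^ 2 * (A ^ k * B ^ (m - k))) := by
  set q : ℂ[X] := C g * ∏ i, (X - C (α i)) with hq
  set P : ℂ[X] := C g * ∏ i, (C (√A : ℂ) * X + C (-(√B * α i) : ℂ)) with hP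
  have hA' : (√A : ℂ) ≠ 0 := by exact_mod_cast (Real.sqrt_pos.mpr hA).ne'
  have hB' : (√B : ℂ) ≠ 0 := by exact_mod_cast (Real.sqrt_pos.mpr hB).ne'
  have hmahler : P.mahlerMeasure = ‖g‖ * ∏ i, max (√A) (√B * ‖α i‖) := by
    rw [hP, mahlerMeasure_mul, mahlerMeasure_const, Finset.prod_eq_multiset_prod,
      prod_mahlerMeasure_eq_mahlerMeasure_prod, Multiset.map_map, ← Finset.prod_eq_multiset_prod]
    congr 1
    refine Finset.prod_congr rfl fun i _ => ?_
    rw [Function.comp_apply, mahlerMeasure_C_mul_X_add_C hA']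
    simp [abs_of_nonneg (Real.sqrt_nonneg _)]
  have hPq : P = C ((√B : ℂ) ^ m) * q.comp (C (√A / √B : ℂ) * X) := by
    rw [hP, hq, mul_comp, C_comp, prod_comp, mul_left_comm, map_pow,
      ← Fin.prod_const m (C (√B : ℂ)), ← Finset.prod_mul_distrib]
    congr 1
    refine Finset.prod_congr rfl fun i _ => ?_
    rw [sub_comp, X_comp, C_comp, mul_sub, ← mul_assoc, ← C_mul, mul_div_cancel₀ _ hB', ← C_mul,
      C_neg, sub_eq_add_neg]
  have hcoeff (k : ℕ) (hk : k ≤ m) :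
      ‖P.coeff k‖ ^ 2 = ‖q.coeff k‖ ^ 2 * (A ^ k * B ^ (m - k)) := by
    rw [hPq, coeff_C_mul, comp_C_mul_X_coeff, norm_mul, norm_mul, norm_pow, norm_pow, norm_div,
      Complex.norm_real, Complex.norm_real, Real.norm_of_nonneg (Real.sqrt_nonneg _),
      Real.norm_of_nonneg (Real.sqrt_nonneg _), mul_pow, mul_pow, ← pow_mul, ← pow_mul, mul_comm m,
      pow_mul, Real.sq_sqrt hB.le, mul_comm k, pow_mul, div_pow, Real.sq_sqrt hA.le,
      Real.sq_sqrt hB.le, div_pow]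
    obtain ⟨j, rfl⟩ := Nat.exists_eq_add_of_le hk
    rw [Nat.add_sub_cancel_left, pow_add]
    field_simp
  have hdeg : P.natDegree ≤ m := by
    refine (natDegree_C_mul_le _ _).trans ((natDegree_prod_le _ _).trans ?_)
    refine (Finset.sum_le_sum fun i _ => natDegree_linear_le).trans ?_
    simp
  rw [← hmahler]
  refine P.mahlerMeasure_le_sqrt_sum_sq_norm_coeff.trans (Real.sqrt_le_sqrt ?_)
  rw [← Finset.sum_congr rfl fun k hk => hcoeff k (Nat.lt_succ_iff.mp (Finset.mem_range.mp hk))]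
  refine Finset.sum_le_sum_of_subset_of_nonneg (fun k hk => ?_) fun _ _ _ => by positivity
  exact Finset.mem_range_succ_iff.mpr ((le_natDegree_of_mem_supp k hk).trans hdeg)

/-- Passing from the `ℓ²` factor to the maximum costs `√2` per root. For `m = 1` both sides agree
exactly, so nothing is lost; the final bound for `M = 1` has no room for an extra `√2`. -/
theorem norm_mul_prod_sqrt_le {m : ℕ} (g : ℂ) (α : Fin m → ℂ) {A B : ℝ} (hA : 0 < A)
    (hB : 0 < B) :
    ‖g‖ * ∏ i, √(A + B * ‖α i‖ ^ 2) ≤ rootConst m *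
      √(∑ k ∈ Finset.range (m + 1),
        ‖(C g * ∏ i, (X - C (α i))).coeff k‖ ^ 2 * (A ^ k * B ^ (m - k))) := by
  rw [rootConst]
  split_ifs with hm
  · subst hm
    rw [one_mul]
    refine le_of_eq ?_
    have h0 : (C g * (X - C (α 0))).coeff 0 = -(g * α 0) := by simp [mul_coeff_zero]
    have h1 : (C g * (X - C (α 0))).coeff 1 = g := by simp [coeff_C_mul, coeff_X]
    simp only [Fin.prod_univ_one, Finset.sum_range_succ, Finset.sum_range_zero, h0, h1]
    rw [← Real.sqrt_sq (norm_nonneg g), ← Real.sqrt_mul (by positivity)]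
    congr 1
    rw [norm_neg, norm_mul, Real.sqrt_sq (norm_nonneg g)]
    ring
  · calc ‖g‖ * ∏ i, √(A + B * ‖α i‖ ^ 2)
        ≤ ‖g‖ * ∏ i, (√2 * max (√A) (√B * ‖α i‖)) := by
          gcongr with i
          exact sqrt_add_le_sqrt_two_mul_max hA hB (norm_nonneg _)
      _ = √2 ^ m * (‖g‖ * ∏ i, max (√A) (√B * ‖α i‖)) := by
          rw [Finset.prod_mul_distrib, Fin.prod_const]
          ring
      _ ≤ _ := by
          gcongr
          exact norm_mul_prod_max_le g α hA hB

/-- Gauss's lemma: the Gauss norm of radius `1` is multiplicative, and on `X - α` it is at least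
`max 1 |α|`. -/
theorem abv_mul_prod_max_le {R : Type*} [Field R] {v : AbsoluteValue R ℝ} (hv : IsNonarchimedean v)
    {m : ℕ} (g : R) (α : Fin m → R) {Y : ℝ}
    (hY : ∀ k, v ((C g * ∏ i, (X - C (α i))).coeff k) ≤ Y) :
    v g * ∏ i, max 1 (v (α i)) ≤ Y := by
  have hmul (s : Finset (Fin m)) :
      (∏ i ∈ s, (X - C (α i))).gaussNorm v 1 = ∏ i ∈ s, (X - C (α i)).gaussNorm v 1 := by
    classical
    induction s using Finset.induction_on with
    | empty => simpa using gaussNorm_C v 1 (1 : R)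
    | insert i s hi ih =>
      rw [Finset.prod_insert hi, Finset.prod_insert hi, gaussNorm_mul hv one_pos, ih]
  obtain ⟨k, hk⟩ := exists_eq_gaussNorm v 1 (C g * ∏ i, (X - C (α i)))
  rw [gaussNorm_mul hv one_pos, gaussNorm_C, hmul, one_pow, mul_one] at hk
  refine le_trans ?_ (hk.le.trans (hY k))
  refine mul_le_mul_of_nonneg_left (Finset.prod_le_prod (fun i _ => by positivity) fun i _ => ?_)
    (v.nonneg g)
  refine max_le ?_ ?_
  · have := le_gaussNorm v (X - C (α i)) zero_le_one 1
    simpa only [coeff_sub, coeff_X_one, coeff_C_succ, zero_sub, sub_zero, map_one, map_neg_eq_map,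
      one_pow,
      mul_one] using this
  · have := le_gaussNorm v (X - C (α i)) zero_le_one 0
    simpa only [coeff_sub, coeff_X_zero, coeff_C_zero, zero_sub, sub_zero, map_one, map_neg_eq_map,
      one_pow,
      mul_one] using this

section RootHeight

variable {L : Type*} [Field L] [NumberField L]

/-- The unnormalised height of an algebraic number `a`, with weights `A` and `B` at the infinite
places. -/
noncomputable def weightedHeight (A B : ℝ) (a : L) : ℝ :=
  (∏ v : InfinitePlace L, √(A + B * v a ^ 2) ^ v.mult) * ∏ᶠ v : FinitePlace L, max 1 (v a)

theorem hasFiniteMulSupport_max_one_finitePlace (a : L) :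
    (fun v : FinitePlace L => max 1 (v a)).HasFiniteMulSupport := by
  rcases eq_or_ne a 0 with rfl | ha
  · simp [Function.HasFiniteMulSupport]
  · have := FinitePlace.hasFiniteMulSupport ha
    fun_prop

theorem weightedHeight_nonneg (A B : ℝ) (a : L) : 0 ≤ weightedHeight A B a :=
  mul_nonneg (Finset.prod_nonneg fun _ _ => by positivity) (finprod_nonneg fun _ => by positivity)

theorem relHeight_le_weightedHeight {κ : Type*} [Fintype κ] {A B : ℝ} {a : L} {z : κ → L}
    (hz : z ≠ 0) (hinf : ∀ v : InfinitePlace L, ∑ j, v (z j) ^ 2 ≤ A + B * v a ^ 2)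
    (hfin : ∀ (v : FinitePlace L) j, v (z j) ≤ max 1 (v a)) :
    relHeight z ≤ weightedHeight A B a := by
  have : Nonempty κ := (Function.ne_iff.mp hz).nonempty
  refine mul_le_mul ?_ ?_ (finprod_iSup_finitePlace_nonneg z)
    (Finset.prod_nonneg fun _ _ => by positivity)
  · refine Finset.prod_le_prod (fun v _ => by positivity) fun v _ => ?_
    gcongr
    exact hinf v
  · exact finprod_le_finprod (hasFiniteMulSupport_iSup_finitePlace hz)
      (fun v => Real.iSup_nonneg fun _ => apply_nonneg v _)
      (hasFiniteMulSupport_max_one_finitePlace a) fun v => ciSup_le (hfin v)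

theorem prod_weightedHeight_le {m : ℕ} {g : L} (hg : g ≠ 0) (α : Fin m → L) {A B W : ℝ}
    (hA : 0 < A) (hB : 0 < B) {κ : Type*} [Fintype κ] {y : κ → L} (hy : y ≠ 0)
    (hinf : ∀ v : InfinitePlace L, ∑ k ∈ Finset.range (m + 1),
      v ((C g * ∏ i, (X - C (α i))).coeff k) ^ 2 * (A ^ k * B ^ (m - k)) ≤ W * ∑ j, v (y j) ^ 2)
    (hfin : ∀ (v : FinitePlace L) k, v ((C g * ∏ i, (X - C (α i))).coeff k) ≤ ⨆ j, v (y j)) :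
    ∏ i, weightedHeight A B (α i) ≤
      (rootConst m * √W) ^ Module.finrank ℚ L * relHeight y := by
  have hloc (v : InfinitePlace L) :
      v g * ∏ i, √(A + B * v (α i) ^ 2) ≤ rootConst m * √W * √(∑ j, v (y j) ^ 2) := by
    have h := norm_mul_prod_sqrt_le (v.embedding g) (fun i => v.embedding (α i)) hA hB
    have hmap : C (v.embedding g) * ∏ i, (X - C (v.embedding (α i))) =
        (C g * ∏ i, (X - C (α i))).map v.embedding := by
      simp [Polynomial.map_prod]
    simp only [hmap, coeff_map, InfinitePlace.norm_embedding_eq] at h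
    rw [mul_assoc, ← Real.sqrt_mul' _ (by positivity)]
    exact h.trans (mul_le_mul_of_nonneg_left (Real.sqrt_le_sqrt (hinf v)) (rootConst_nonneg m))
  have hna (v : FinitePlace L) : IsNonarchimedean v.val := fun x y => FinitePlace.add_le v x y
  calc ∏ i, weightedHeight A B (α i)
      -- The product formula inserts the leading coefficient `g` for free, as the local estimates
      -- require.
      = ((∏ v : InfinitePlace L, v g ^ v.mult) * ∏ᶠ v : FinitePlace L, v g) *
        ∏ i, weightedHeight A B (α i) := by
        rw [prod_abs_eq_one hg, one_mul]
    _ = (∏ v : InfinitePlace L, (v g * ∏ i, √(A + B * v (α i) ^ 2)) ^ v.mult) *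
        ∏ᶠ v : FinitePlace L, v g * ∏ i, max 1 (v (α i)) := by
        simp only [weightedHeight, Finset.prod_mul_distrib, mul_pow]
        rw [finprod_mul_distrib (FinitePlace.hasFiniteMulSupport hg)
          (.prod (fun i => hasFiniteMulSupport_max_one_finitePlace (α i)) _),
          finprod_prod_comm _ _ fun i _ => hasFiniteMulSupport_max_one_finitePlace (α i),
          Finset.prod_comm, mul_mul_mul_comm]
        simp only [Finset.prod_pow]
    _ ≤ (∏ v : InfinitePlace L, (rootConst m * √W * √(∑ j, v (y j) ^ 2)) ^ v.mult) *
        ∏ᶠ v : FinitePlace L, ⨆ j, v (y j) := by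
        refine mul_le_mul ?_ ?_ ?_ ?_
        · refine Finset.prod_le_prod (fun v _ => by positivity) fun v _ => ?_
          exact pow_le_pow_left₀ (by positivity) (hloc v) _
        · refine finprod_le_finprod (.mul (FinitePlace.hasFiniteMulSupport hg)
            (.prod (fun i => hasFiniteMulSupport_max_one_finitePlace (α i)) _))
            (fun v => mul_nonneg (apply_nonneg v _) (Finset.prod_nonneg fun _ _ => by positivity))
            (hasFiniteMulSupport_iSup_finitePlace hy) fun v => ?_
          exact abv_mul_prod_max_le (hna v) g α (hfin v)
        · exact finprod_nonneg fun v =>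
            mul_nonneg (apply_nonneg v _) (Finset.prod_nonneg fun _ _ => by positivity)
        · have := rootConst_nonneg m
          exact Finset.prod_nonneg fun v _ => by positivity
    _ = (rootConst m * √W) ^ Module.finrank ℚ L * relHeight y := by
        simp only [mul_pow _ (√(∑ j, _)), Finset.prod_mul_distrib]
        rw [Finset.prod_pow_eq_pow_sum, InfinitePlace.sum_mult_eq, relHeight, mul_assoc]

/-- The root of least weighted height works: its `m`-th power is at most the product over all roots.
The vector `z` is quantified after `i` because it will be built from the chosen root. -/
theorem exists_root_height_le {m : ℕ} (hm : m ≠ 0) {g : L} (hg : g ≠ 0) (α : Fin m → L)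
    {A B W : ℝ} (hA : 0 < A) (hB : 0 < B) {κ : Type*} [Fintype κ] {y : κ → L} (hy : y ≠ 0)
    (hinf : ∀ v : InfinitePlace L, ∑ k ∈ Finset.range (m + 1),
      v ((C g * ∏ i, (X - C (α i))).coeff k) ^ 2 * (A ^ k * B ^ (m - k)) ≤ W * ∑ j, v (y j) ^ 2)
    (hfin : ∀ (v : FinitePlace L) k, v ((C g * ∏ i, (X - C (α i))).coeff k) ≤ ⨆ j, v (y j))
    {ι : Type*} [Fintype ι] :
    ∃ i, ∀ z : ι → L, z ≠ 0 →
      (∀ v : InfinitePlace L, ∑ j, v (z j) ^ 2 ≤ A + B * v (α i) ^ 2) →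
      (∀ (v : FinitePlace L) j, v (z j) ≤ max 1 (v (α i))) →
      height z ^ m ≤ rootConst m * √W * height y := by
  have : NeZero m := ⟨hm⟩
  obtain ⟨i, hi⟩ := Finite.exists_min fun i => weightedHeight A B (α i)
  refine ⟨i, fun z hz hzinf hzfin => ?_⟩
  have h1 : relHeight z ^ m ≤ (rootConst m * √W) ^ Module.finrank ℚ L * relHeight y := by
    refine le_trans ?_ (prod_weightedHeight_le hg α hA hB hy hinf hfin)
    refine (pow_le_pow_left₀ (relHeight_nonneg z)
      (relHeight_le_weightedHeight hz hzinf hzfin) m).trans ?_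
    rw [← Fin.prod_const]
    exact Finset.prod_le_prod (fun _ _ => weightedHeight_nonneg A B _) fun j _ => hi j
  rw [← height_pow_finrank hz, ← height_pow_finrank hy, ← mul_pow, ← pow_mul, mul_comm, pow_mul]
    at h1
  exact (pow_le_pow_iff_left₀ (pow_nonneg (height_nonneg z) _)
    (mul_nonneg (mul_nonneg (rootConst_nonneg m) (Real.sqrt_nonneg W)) (height_nonneg y))
    (Module.finrank_pos (R := ℚ) (M := L)).ne').mp h1

end RootHeight

/-! ### Specialization to one variable -/

section Substitution

variable {σ : Type*} [Fintype σ]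

/-- The exponents occurring in `F` whose total degree in the variables of `J` is `k`. -/
def partSupport {R : Type*} [CommSemiring R] (F : MvPolynomial σ R) (J : Finset σ) (k : ℕ) :
    Finset (σ →₀ ℕ) :=
  {n ∈ F.support | ∑ i ∈ J, n i = k}

theorem mem_partSupport {σ R : Type*} [CommSemiring R] {F : MvPolynomial σ R} {J : Finset σ} {k : ℕ}
    {n : σ →₀ ℕ} : n ∈ partSupport F J k ↔ n ∈ F.support ∧ ∑ i ∈ J, n i = k :=
  Finset.mem_filter

/-- The univariate polynomial obtained from `F` by substituting `a i * X` for the variables `i ∈ J`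
and `a i` for the other ones. -/
noncomputable def specialize {R : Type*} [CommRing R] (F : MvPolynomial σ R) (J : Finset σ)
    (a : σ → ℤ) : R[X] :=
  ∑ n ∈ F.support, monomial (∑ i ∈ J, n i) (F.coeff n * ∏ i, (a i : R) ^ n i)

theorem coeff_specialize {R : Type*} [CommRing R] (F : MvPolynomial σ R) (J : Finset σ)
    (a : σ → ℤ) (k : ℕ) :
    (specialize F J a).coeff k =
      ∑ n ∈ partSupport F J k, F.coeff n * ∏ i, (a i : R) ^ n i := by
  rw [specialize, finsetSum_coeff, partSupport, Finset.sum_filter]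
  exact Finset.sum_congr rfl fun n _ => coeff_monomial

theorem natDegree_specialize_le {R : Type*} [CommRing R] (F : MvPolynomial σ R) (J : Finset σ)
    (a : σ → ℤ) : (specialize F J a).natDegree ≤ F.totalDegree := by
  refine natDegree_sum_le_of_forall_le _ _ fun n hn => (natDegree_monomial_le _).trans ?_
  refine (Finset.sum_le_sum_of_subset (Finset.subset_univ J)).trans ?_
  refine le_trans (le_of_eq ?_) (MvPolynomial.le_totalDegree hn)
  rw [Finsupp.sum_fintype _ _ fun _ => rfl]

theorem aeval_specialize {R A : Type*} [CommRing R] [CommRing A] [Algebra R A] [DecidableEq σ]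
    (F : MvPolynomial σ R) (J : Finset σ) (a : σ → ℤ) (t : A) :
    aeval t (specialize F J a) =
      MvPolynomial.aeval (fun i => (a i : A) * if i ∈ J then t else 1) F := by
  rw [MvPolynomial.aeval_def, MvPolynomial.eval₂_eq', specialize, map_sum]
  refine Finset.sum_congr rfl fun n _ => ?_
  simp only [mul_pow, Finset.prod_mul_distrib, ite_pow, one_pow, Finset.prod_ite_mem,
    Finset.univ_inter, Finset.prod_pow_eq_pow_sum, aeval_monomial, map_mul, map_prod, map_pow,
    map_intCast]
  ring

theorem degOver_le {σ K : Type*} [Field K] [Algebra K (AlgebraicClosure ℚ)] {G : K[X]} (hG : G ≠ 0)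
    {t : AlgebraicClosure ℚ} (ht : aeval t G = 0) {z : σ → AlgebraicClosure ℚ}
    (hz : ∀ i, z i ∈ IntermediateField.adjoin K {t}) : degOver K z ≤ G.natDegree := by
  have hint : IsIntegral K t := (isAlgebraic_iff_isIntegral).mp ⟨G, hG, ht⟩
  have : FiniteDimensional K (IntermediateField.adjoin K {t}) :=
    IntermediateField.adjoin.finiteDimensional hint
  have hle : IntermediateField.adjoin K (Set.range z) ≤ IntermediateField.adjoin K {t} :=
    IntermediateField.adjoin_le_iff.mpr (by rintro _ ⟨i, rfl⟩; exact hz i)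
  refine (IntermediateField.finrank_le_of_le_right hle).trans ?_
  rw [IntermediateField.adjoin.finrank hint]
  exact natDegree_le_natDegree (minpoly.degree_le_of_ne_zero K t hG ht)

theorem intCast_mul_ite_mem_adjoin {σ K : Type*} [Field K] [Algebra K (AlgebraicClosure ℚ)]
    [DecidableEq σ] (J : Finset σ) (a : σ → ℤ) (t : AlgebraicClosure ℚ) (i : σ) :
    (a i : AlgebraicClosure ℚ) * (if i ∈ J then t else 1) ∈ IntermediateField.adjoin K {t} := by
  refine mul_mem (intCast_mem _ _) ?_
  split_ifs
  · exact IntermediateField.mem_adjoin_simple_self K t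
  · exact one_mem _

/-- Removing the power of `X` leaves a nonconstant factor without the root `0`, so that the
coordinates of the zero do not vanish. -/
theorem exists_eq_X_pow_mul {R : Type*} [Field R] {G : R[X]}
    (h : G.natTrailingDegree < G.natDegree) :
    ∃ p : R[X], G = X ^ G.natTrailingDegree * p ∧
      p.natDegree = G.natDegree - G.natTrailingDegree ∧ p.coeff 0 ≠ 0 := by
  have hG : G ≠ 0 := by
    rintro rfl
    simp at h
  obtain ⟨p, hp⟩ : X ^ G.natTrailingDegree ∣ G :=
    X_pow_dvd_iff.mpr fun d hd => coeff_eq_zero_of_lt_natTrailingDegree hd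
  have hp0 : p ≠ 0 := by
    rintro rfl
    exact hG (by rw [hp, mul_zero])
  refine ⟨p, hp, ?_, ?_⟩
  · have := congrArg natDegree hp
    rw [natDegree_mul (pow_ne_zero _ X_ne_zero) hp0, natDegree_X_pow] at this
    omega
  · have h1 : G.coeff G.natTrailingDegree ≠ 0 := fun h => hG (trailingCoeff_eq_zero.mp h)
    have h2 := coeff_X_pow_mul p G.natTrailingDegree 0
    rw [← hp, zero_add] at h2
    rwa [← h2]

theorem exists_eq_prod_X_sub_C {E : Type*} [Field E] [IsAlgClosed E] (q : E[X]) {m : ℕ}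
    (hm : q.natDegree = m) :
    ∃ α : Fin m → E, q = C q.leadingCoeff * ∏ i, (X - C (α i)) := by
  subst hm
  have hs := IsAlgClosed.splits q
  obtain ⟨l, hl⟩ := Quot.exists_rep q.roots
  have hl' : q.roots = (l : Multiset E) := hl.symm
  have hlen : l.length = q.natDegree := by
    rw [hs.natDegree_eq_card_roots, hl', Multiset.coe_card]
  rw [← hlen]
  refine ⟨l.get, ?_⟩
  conv_lhs => rw [hs.eq_prod_roots, hl', Multiset.map_coe, Multiset.prod_coe]
  rw [← List.prod_ofFn]
  congr 2
  conv_lhs => rw [← List.ofFn_get l]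
  rw [List.map_ofFn]
  rfl

end Substitution

theorem isAlgebraic_algebraicClosure_rat (K : Type*) [Field K] [CharZero K]
    [Algebra K (AlgebraicClosure ℚ)] : Algebra.IsAlgebraic K (AlgebraicClosure ℚ) := by
  have : Algebra.IsAlgebraic ℚ (AlgebraicClosure ℚ) := by
    convert AlgebraicClosure.isAlgebraic ℚ
    · rfl
    · exact Subsingleton.elim _ _
  exact Algebra.IsAlgebraic.tower_top (K := ℚ) K

/-! ### Zeros of small height from a specialization -/

section ZeroOfSpecialization

variable {K : Type*} [Field K] [NumberField K] {σ : Type*} [Fintype σ]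

theorem infinitePlace_intCast {L : Type*} [Field L] (v : InfinitePlace L) (a : ℤ) :
    v (a : L) = |(a : ℝ)| := by
  rw [← InfinitePlace.norm_embedding_eq, map_intCast, Complex.norm_intCast]

theorem finitePlace_intCast_le_one {L : Type*} [Field L] [NumberField L] (v : FinitePlace L)
    (a : ℤ) : v (a : L) ≤ 1 :=
  IsNonarchimedean.apply_intCast_le_one (f := v.val) fun x y => FinitePlace.add_le v x y

theorem finitePlace_sum_le {L : Type*} [Field L] [NumberField L] (v : FinitePlace L) {κ : Type*}
    (s : Finset κ) (f : κ → L) {Y : ℝ} (hY : 0 ≤ Y) (h : ∀ i ∈ s, v (f i) ≤ Y) :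
    v (∑ i ∈ s, f i) ≤ Y := by
  classical
  induction s using Finset.induction_on with
  | empty => simpa using hY
  | insert i s hi ih =>
    rw [Finset.sum_insert hi]
    exact (FinitePlace.add_le v _ _).trans (max_le (h i (Finset.mem_insert_self i s))
      (ih fun j hj => h j (Finset.mem_insert_of_mem hj)))

/-- Cauchy–Schwarz separates the coefficients of `F` from the values of the monomials at `a`. -/
theorem infinitePlace_sum_sq_le {L : Type*} [Field L] (v : InfinitePlace L) (s : Finset (σ →₀ ℕ))
    (c : (σ →₀ ℕ) → L) (a : σ → ℤ) :
    v (∑ n ∈ s, c n * ∏ i, (a i : L) ^ n i) ^ 2 ≤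
      (∑ n ∈ s, v (c n) ^ 2) * ∑ n ∈ s, ∏ i, ((a i : ℝ) ^ 2) ^ n i := by
  have h1 : v (∑ n ∈ s, c n * ∏ i, (a i : L) ^ n i) ≤
      ∑ n ∈ s, v (c n) * ∏ i, |(a i : ℝ)| ^ n i := by
    refine (v.val.sum_le s _).trans (Finset.sum_le_sum fun n _ => le_of_eq ?_)
    change v _ = _
    rw [map_mul, map_prod]
    simp only [map_pow, infinitePlace_intCast]
  refine (pow_le_pow_left₀ (apply_nonneg v _) h1 2).trans ?_
  refine (Finset.sum_mul_sq_le_sq_mul_sq s _ _).trans (le_of_eq ?_)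
  congr 1
  refine Finset.sum_congr rfl fun n _ => ?_
  rw [← Finset.prod_pow]
  refine Finset.prod_congr rfl fun i _ => ?_
  rw [← pow_mul, mul_comm, pow_mul, sq_abs]

theorem numberField_of_finiteDimensional (L : Type*) [Field L] [Algebra K L]
    [FiniteDimensional K L] : NumberField L where
  to_charZero := charZero_of_injective_algebraMap (algebraMap K L).injective
  to_finiteDimensional := by
    have : CharZero L := charZero_of_injective_algebraMap (algebraMap K L).injective
    exact Module.Finite.trans K L

variable [Algebra K (AlgebraicClosure ℚ)]

/-- The constant `W` collects, uniformly in the coefficient index `k`, the Cauchy–Schwarz factor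
from the monomials at `a` and the weight that the Mahler bound puts on that coefficient. -/
theorem exists_zero_of_specialize [DecidableEq σ] (F : MvPolynomial σ K) (J : Finset σ) (a : σ → ℤ)
    (ha : ∀ i, a i ≠ 0) {l m : ℕ} (hl : (specialize F J a).natTrailingDegree = l)
    (hm : (specialize F J a).natDegree = l + m) (hm0 : m ≠ 0) {W : ℝ}
    (hJ : J.Nonempty) (hJc : Jᶜ.Nonempty)
    (hW : ∀ k ≤ m, (∑ n ∈ partSupport F J (k + l), ∏ i, ((a i : ℝ) ^ 2) ^ n i) *
      ((∑ i ∈ Jᶜ, (a i : ℝ) ^ 2) ^ k * (∑ i ∈ J, (a i : ℝ) ^ 2) ^ (m - k)) ≤ W) :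
    ∃ z : σ → AlgebraicClosure ℚ, degOver K z ≤ F.totalDegree ∧ MvPolynomial.aeval z F = 0 ∧
      (∀ i, z i ≠ 0) ∧ algHeight z ^ m ≤ rootConst m * √W * polyHeight F := by
  set G := specialize F J a with hGdef
  set A : ℝ := ∑ i ∈ Jᶜ, (a i : ℝ) ^ 2 with hAdef
  set B : ℝ := ∑ i ∈ J, (a i : ℝ) ^ 2 with hBdef
  have hsq (i : σ) : 0 < (a i : ℝ) ^ 2 := by
    have : (a i : ℝ) ≠ 0 := by exact_mod_cast ha i
    positivity
  have hA : 0 < A := Finset.sum_pos (fun i _ => hsq i) hJc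
  have hB : 0 < B := Finset.sum_pos (fun i _ => hsq i) hJ
  have hG0 : G ≠ 0 := by
    intro h
    rw [h, natDegree_zero] at hm
    omega
  obtain ⟨p, hGp, hpdeg, hp0⟩ := exists_eq_X_pow_mul (G := G) (by omega)
  rw [hl] at hGp
  have hpm : p.natDegree = m := by omega
  have hpcoeff (k : ℕ) : p.coeff k = G.coeff (k + l) := by rw [hGp, coeff_X_pow_mul]
  obtain ⟨α', hα'⟩ := exists_eq_prod_X_sub_C (p.map (algebraMap K (AlgebraicClosure ℚ)))
    ((natDegree_map _).trans hpm)
  rw [leadingCoeff_map] at hα'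
  set L := IntermediateField.adjoin K (Set.range α') with hL
  have hKalg := isAlgebraic_algebraicClosure_rat K
  have : FiniteDimensional K L :=
    IntermediateField.finiteDimensional_adjoin fun x _ => Algebra.IsIntegral.isIntegral x
  have : NumberField L := numberField_of_finiteDimensional (K := K) L
  let α (i : Fin m) : L := ⟨α' i, IntermediateField.subset_adjoin K _ (Set.mem_range_self i)⟩
  have hα (i : Fin m) : algebraMap L (AlgebraicClosure ℚ) (α i) = α' i := rfl
  have hsplit : C (algebraMap K L p.leadingCoeff) * ∏ i, (X - C (α i)) =
      p.map (algebraMap K L) := by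
    apply map_injective _ (algebraMap L (AlgebraicClosure ℚ)).injective
    rw [Polynomial.map_map, ← IsScalarTower.algebraMap_eq, hα', Polynomial.map_mul, map_C,
      Polynomial.map_prod, ← IsScalarTower.algebraMap_apply]
    simp [hα]
  have hg : algebraMap K L p.leadingCoeff ≠ 0 := by
    rw [Ne, map_eq_zero, leadingCoeff_eq_zero]
    rintro rfl
    simp at hp0
  set y : F.support → L := fun n => algebraMap K L (F.coeff n) with hy
  have hF0 : F ≠ 0 := by
    rintro rfl
    simp [hGdef, specialize] at hG0
  obtain ⟨n₀, hn₀⟩ := MvPolynomial.support_nonempty.mpr hF0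
  have hx0 : (fun n : F.support => F.coeff n) ≠ 0 :=
    Function.ne_iff.mpr ⟨⟨n₀, hn₀⟩, MvPolynomial.mem_support_iff.mp hn₀⟩
  have hy0 : y ≠ 0 := Function.ne_iff.mpr ⟨⟨n₀, hn₀⟩, by
    simpa [hy] using MvPolynomial.mem_support_iff.mp hn₀⟩
  have hyF : height y = polyHeight F := height_algebraMap hx0
  have hcoeff (k : ℕ) : (C (algebraMap K L p.leadingCoeff) * ∏ i, (X - C (α i))).coeff k =
      ∑ n ∈ partSupport F J (k + l), algebraMap K L (F.coeff n) * ∏ i, (a i : L) ^ n i := by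
    rw [hsplit, coeff_map, hpcoeff, hGdef, coeff_specialize, map_sum]
    simp
  have hinf (v : InfinitePlace L) : ∑ k ∈ Finset.range (m + 1),
      v ((C (algebraMap K L p.leadingCoeff) * ∏ i, (X - C (α i))).coeff k) ^ 2 *
        (A ^ k * B ^ (m - k)) ≤ W * ∑ j, v (y j) ^ 2 := by
    have hy2 : ∑ j, v (y j) ^ 2 = ∑ n ∈ F.support, v (algebraMap K L (F.coeff n)) ^ 2 :=
      Finset.sum_coe_sort F.support fun n => v (algebraMap K L (F.coeff n)) ^ 2
    have hW0 : 0 ≤ W := le_trans (by positivity) (hW 0 m.zero_le)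
    calc _ ≤ ∑ k ∈ Finset.range (m + 1),
          W * ∑ n ∈ partSupport F J (k + l), v (algebraMap K L (F.coeff n)) ^ 2 := by
          refine Finset.sum_le_sum fun k hk => ?_
          rw [hcoeff]
          refine (mul_le_mul_of_nonneg_right (infinitePlace_sum_sq_le v _ _ a)
            (by positivity)).trans ?_
          rw [mul_assoc, mul_comm W]
          exact mul_le_mul_of_nonneg_left (hW k (Finset.mem_range_succ_iff.mp hk))
            (by positivity)
      _ ≤ W * ∑ j, v (y j) ^ 2 := by
          rw [← Finset.mul_sum, hy2]
          refine mul_le_mul_of_nonneg_left ?_ hW0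
          simp only [partSupport, Finset.sum_filter]
          rw [Finset.sum_comm]
          refine Finset.sum_le_sum fun n _ => ?_
          rw [← Finset.sum_filter, Finset.sum_const, nsmul_eq_mul]
          refine mul_le_of_le_one_left (by positivity) ?_
          -- Each exponent contributes to at most one coefficient of `p`, so summing over `k` counts
          -- no coefficient of `F` twice.
          exact_mod_cast Finset.card_le_one.mpr fun i hi j hj => by
            simp only [Finset.mem_filter] at hi hj
            omega
  have hfin (v : FinitePlace L) (k : ℕ) :
      v ((C (algebraMap K L p.leadingCoeff) * ∏ i, (X - C (α i))).coeff k) ≤ ⨆ j, v (y j) := by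
    rw [hcoeff]
    refine finitePlace_sum_le v _ _ (Real.iSup_nonneg fun _ => apply_nonneg v _) fun n hn => ?_
    rw [map_mul, map_prod]
    refine (mul_le_of_le_one_right (apply_nonneg v _) (Finset.prod_le_one
      (fun i _ => apply_nonneg v _) fun i _ => ?_)).trans
      (Finite.le_ciSup (fun j => v (y j)) ⟨n, (mem_partSupport.mp hn).1⟩)
    rw [map_pow]
    exact pow_le_one₀ (apply_nonneg v _) (finitePlace_intCast_le_one v _)
  obtain ⟨i, hi⟩ := exists_root_height_le (ι := σ) hm0 hg α hA hB hy0 hinf hfin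
  have hroot : aeval (α' i) p = 0 := by
    rw [aeval_def, ← eval_map, hα', eval_mul, eval_prod,
      Finset.prod_eq_zero (Finset.mem_univ i) (by simp), mul_zero]
  have hrootG : aeval (α' i) G = 0 := by rw [hGp, map_mul, hroot, mul_zero]
  have hαi : α i ≠ 0 := by
    intro h
    have h2 : α' i = 0 := by rw [← hα, h, map_zero]
    rw [h2, ← coeff_zero_eq_aeval_zero', map_eq_zero] at hroot
    exact hp0 hroot
  set z : σ → L := fun j => (a j : L) * if j ∈ J then α i else 1 with hz
  have hz0 (j : σ) : z j ≠ 0 := by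
    refine mul_ne_zero (by exact_mod_cast ha j) ?_
    split_ifs
    · exact hαi
    · exact one_ne_zero
  have hzalg : (fun j => (a j : AlgebraicClosure ℚ) * if j ∈ J then α' i else 1) =
      fun j => algebraMap L (AlgebraicClosure ℚ) (z j) := by
    funext j
    rw [hz, map_mul, map_intCast, apply_ite (algebraMap L _), map_one, hα]
  have hzne : z ≠ 0 := Function.ne_iff.mpr ⟨hJ.choose, hz0 _⟩
  refine ⟨fun j => (a j : AlgebraicClosure ℚ) * if j ∈ J then α' i else 1, ?_, ?_, ?_, ?_⟩
  · exact (degOver_le hG0 hrootG fun j => intCast_mul_ite_mem_adjoin J a _ j).trans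
      (natDegree_specialize_le F J a)
  · rw [← aeval_specialize, hrootG]
  · intro j
    refine (congrFun hzalg j).trans_ne ?_
    simpa using hz0 j
  · rw [hzalg, algHeight_algebraMap hzne, ← hyF]
    refine hi z hzne (fun v => le_of_eq ?_) fun v j => ?_
    · rw [← Finset.sum_compl_add_sum J, hAdef, hBdef, Finset.sum_mul]
      congr 1
      · refine Finset.sum_congr rfl fun j hj => ?_
        simp only [hz, if_neg (Finset.mem_compl.mp hj), mul_one, infinitePlace_intCast, sq_abs]
      · refine Finset.sum_congr rfl fun j hj => ?_
        simp only [hz, if_pos hj, map_mul, infinitePlace_intCast, mul_pow, sq_abs]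
    · rw [hz, map_mul]
      refine (mul_le_of_le_one_left (apply_nonneg v _) (finitePlace_intCast_le_one v _)).trans ?_
      split_ifs
      · exact le_max_right _ _
      · rw [map_one]
        exact le_max_left _ _

/-- Here `z = t • a` for a nonzero root `t`, so its height is that of the integer vector `a`, whose
finite part is at most `1`. Any nonzero root will do. -/
theorem exists_zero_on_line [DecidableEq σ] [Nonempty σ] (F : MvPolynomial σ K) (a : σ → ℤ)
    (ha : ∀ i, a i ≠ 0) (hdeg : (specialize F Finset.univ a).natTrailingDegree <
      (specialize F Finset.univ a).natDegree) :
    ∃ z : σ → AlgebraicClosure ℚ, degOver K z ≤ F.totalDegree ∧ MvPolynomial.aeval z F = 0 ∧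
      (∀ i, z i ≠ 0) ∧ algHeight z ≤ √(∑ i, (a i : ℝ) ^ 2) := by
  set G := specialize F Finset.univ a with hGdef
  have hG0 : G ≠ 0 := by
    rintro h
    simp [h] at hdeg
  obtain ⟨p, hGp, hpdeg, hp0⟩ := exists_eq_X_pow_mul hdeg
  have hpdeg' : p.degree ≠ 0 := by
    intro h
    have : p.natDegree = 0 := natDegree_eq_of_degree_eq_some h
    omega
  obtain ⟨t, hroot⟩ := IsAlgClosed.exists_aeval_eq_zero (AlgebraicClosure ℚ) p hpdeg'
  have hrootG : aeval t G = 0 := by rw [hGp, map_mul, hroot, mul_zero]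
  have ht0 : t ≠ 0 := by
    rintro rfl
    rw [← coeff_zero_eq_aeval_zero', map_eq_zero] at hroot
    exact hp0 hroot
  have hKalg := isAlgebraic_algebraicClosure_rat K
  set L := IntermediateField.adjoin K {t} with hL
  have : FiniteDimensional K L :=
    IntermediateField.adjoin.finiteDimensional (Algebra.IsIntegral.isIntegral t)
  have : NumberField L := numberField_of_finiteDimensional (K := K) L
  let t' : L := ⟨t, IntermediateField.mem_adjoin_simple_self K t⟩
  have ht' : t' ≠ 0 := fun h => ht0 (congrArg (algebraMap L (AlgebraicClosure ℚ)) h)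
  refine ⟨fun j => (a j : AlgebraicClosure ℚ) * if j ∈ Finset.univ then t else 1, ?_, ?_, ?_, ?_⟩
  · exact (degOver_le hG0 hrootG fun j => intCast_mul_ite_mem_adjoin Finset.univ a _ j).trans
      (natDegree_specialize_le F Finset.univ a)
  · rw [← aeval_specialize, hrootG]
  · intro j
    simp only [Finset.mem_univ, if_true]
    exact mul_ne_zero (by exact_mod_cast ha j) ht0
  · have hz : (fun j => (a j : AlgebraicClosure ℚ) * if j ∈ Finset.univ then t else 1) =
        fun j => algebraMap L (AlgebraicClosure ℚ) ((t' • fun j => (a j : L)) j) := by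
      funext j
      rw [if_pos (Finset.mem_univ j), Pi.smul_apply, smul_eq_mul, map_mul, map_intCast, mul_comm]
      rfl
    have hne : (fun j => (a j : L)) ≠ 0 :=
      Function.ne_iff.mpr ⟨Classical.arbitrary σ, by simpa using ha _⟩
    have hne' : (t' • fun j => (a j : L)) ≠ 0 := smul_ne_zero ht' hne
    rw [hz, algHeight_algebraMap hne']
    refine (pow_le_pow_iff_left₀ (height_nonneg _) (Real.sqrt_nonneg _)
      (Module.finrank_pos (R := ℚ) (M := L)).ne').mp ?_
    rw [height_pow_finrank hne', relHeight_smul _ ht', relHeight]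
    have h1 : ∏ v : InfinitePlace L, √(∑ i, v (a i : L) ^ 2) ^ v.mult =
        √(∑ i, (a i : ℝ) ^ 2) ^ Module.finrank ℚ L := by
      simp only [infinitePlace_intCast, sq_abs]
      rw [Finset.prod_pow_eq_pow_sum, InfinitePlace.sum_mult_eq]
    rw [h1]
    refine mul_le_of_le_one_right (by positivity) ?_
    rw [← finprod_one (α := FinitePlace L)]
    exact finprod_le_finprod (hasFiniteMulSupport_iSup_finitePlace hne)
      (fun v => Real.iSup_nonneg fun _ => apply_nonneg v _) (by simp [Function.HasFiniteMulSupport])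
      fun v => ciSup_le fun j => finitePlace_intCast_le_one v _

end ZeroOfSpecialization

/-! ### Small integers preserving two given coefficients -/

section Nonvanishing

variable {K : Type*} [Field K] {σ : Type*} [Fintype σ]

/-- The sum of the terms of `F` whose total degree in the variables of `J` is `k`. -/
noncomputable def part (F : MvPolynomial σ K) (J : Finset σ) (k : ℕ) : MvPolynomial σ K :=
  ∑ n ∈ partSupport F J k, MvPolynomial.monomial n (F.coeff n)

theorem coeff_part {σ : Type*} [DecidableEq σ] (F : MvPolynomial σ K) (J : Finset σ) (k : ℕ)
    (n : σ →₀ ℕ) :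
    (part F J k).coeff n = if n ∈ partSupport F J k then F.coeff n else 0 := by
  simp [part, MvPolynomial.coeff_sum, MvPolynomial.coeff_monomial]

theorem support_part {σ : Type*} (F : MvPolynomial σ K) (J : Finset σ) (k : ℕ) :
    (part F J k).support = partSupport F J k := by
  classical
  ext n
  rw [MvPolynomial.mem_support_iff, coeff_part]
  simp only [mem_partSupport, MvPolynomial.mem_support_iff]
  grind

theorem eval_part (F : MvPolynomial σ K) (J : Finset σ) (k : ℕ) (a : σ → ℤ) :
    MvPolynomial.eval (fun i => (a i : K)) (part F J k) = (specialize F J a).coeff k := by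
  rw [coeff_specialize, part, map_sum]
  refine Finset.sum_congr rfl fun n _ => ?_
  rw [MvPolynomial.eval_monomial, Finsupp.prod_fintype _ _ fun _ => pow_zero _]

theorem part_ne_zero {σ : Type*} {F : MvPolynomial σ K} {J : Finset σ} {k : ℕ}
    (h : (partSupport F J k).Nonempty) : part F J k ≠ 0 := by
  rwa [← MvPolynomial.support_nonempty, support_part]

theorem exists_int_eval_ne_zero [CharZero K] {P : MvPolynomial σ K} (hP : P ≠ 0) (S : σ → Finset ℤ)
    (hS : ∀ i, P.degreeOf i < (S i).card) :
    ∃ a : σ → ℤ, (∀ i, a i ∈ S i) ∧ MvPolynomial.eval (fun i => (a i : K)) P ≠ 0 := by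
  classical
  by_contra! h
  refine hP (MvPolynomial.eq_zero_of_eval_zero_at_prod_finset P
    (fun i => (S i).image (Int.cast : ℤ → K)) (fun i => ?_) fun x hx => ?_)
  · rw [Finset.card_image_of_injective _ Int.cast_injective]
    exact hS i
  · choose a ha hax using fun i => Finset.mem_image.mp (hx i)
    rw [← h a ha]
    congr 2
    exact funext fun i => (hax i).symm

theorem exists_int_coeff_specialize_ne_zero [CharZero K]
    {F : MvPolynomial σ K} {J : Finset σ} {k l : ℕ}
    (hk : (partSupport F J k).Nonempty) (hl : (partSupport F J l).Nonempty) (S : σ → Finset ℤ)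
    (hS : ∀ i, (part F J k).degreeOf i + (part F J l).degreeOf i < (S i).card) :
    ∃ a : σ → ℤ, (∀ i, a i ∈ S i) ∧ (specialize F J a).coeff k ≠ 0 ∧
      (specialize F J a).coeff l ≠ 0 := by
  obtain ⟨a, ha, h⟩ := exists_int_eval_ne_zero (mul_ne_zero (part_ne_zero hk) (part_ne_zero hl)) S
    fun i => (MvPolynomial.degreeOf_mul_le i _ _).trans_lt (hS i)
  rw [map_mul, eval_part, eval_part] at h
  exact ⟨a, ha, left_ne_zero_of_mul h, right_ne_zero_of_mul h⟩

theorem sum_le_totalDegree {F : MvPolynomial σ K} {n : σ →₀ ℕ} (hn : n ∈ F.support) :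
    ∑ i, n i ≤ F.totalDegree := by
  refine le_trans (le_of_eq ?_) (MvPolynomial.le_totalDegree hn)
  rw [Finsupp.sum_fintype _ _ fun _ => rfl]

theorem degreeOf_part_le {σ : Type*} {F : MvPolynomial σ K} {J : Finset σ} {k : ℕ} {i : σ} {d : ℕ}
    (h : ∀ n ∈ partSupport F J k, n i ≤ d) : (part F J k).degreeOf i ≤ d := by
  rw [MvPolynomial.degreeOf_le_iff, support_part]
  exact h

/-- There are `2M` nonzero integers of absolute value at most `M`, so the product of the two parts
must have degree below `2M` in each variable. Degree `2M` in `X_i` would put `X_i^M` in both parts,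
whereas the set `J` fixes the one part it belongs to. -/
theorem exists_bounded_coeff_specialize_ne_zero [CharZero K]
    {F : MvPolynomial σ K} {J : Finset σ} {k l M : ℕ}
    (hM : F.totalDegree ≤ M) (hM0 : 0 < M) (hkl : k ≠ l)
    (hk : (partSupport F J k).Nonempty) (hl : (partSupport F J l).Nonempty) :
    ∃ a : σ → ℤ, (∀ i, a i ≠ 0 ∧ |a i| ≤ M) ∧ (specialize F J a).coeff k ≠ 0 ∧
      (specialize F J a).coeff l ≠ 0 := by
  classical
  have hle (k : ℕ) (i : σ) : (part F J k).degreeOf i ≤ M := degreeOf_part_le fun n hn =>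
    (Finset.single_le_sum (f := n) (fun _ _ => Nat.zero_le _) (Finset.mem_univ i)).trans
      ((sum_le_totalDegree (mem_partSupport.mp hn).1).trans hM)
  have htop (k : ℕ) (i : σ) (h : M ≤ (part F J k).degreeOf i) : k = if i ∈ J then M else 0 := by
    rw [← not_lt, MvPolynomial.degreeOf_lt_iff hM0, support_part] at h
    push Not at h
    obtain ⟨n, hn, hni⟩ := h
    rw [mem_partSupport] at hn
    have hsum := (sum_le_totalDegree hn.1).trans hM
    rw [← Finset.add_sum_erase _ _ (Finset.mem_univ i)] at hsum
    have hz : ∀ j, j ≠ i → n j = 0 := fun j hj => by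
      have := Finset.single_le_sum (f := n) (fun _ _ => Nat.zero_le _)
        (Finset.mem_erase.mpr ⟨hj, Finset.mem_univ j⟩)
      omega
    have hnM : n i = M := by omega
    rw [← hn.2]
    split_ifs with hi
    · rw [Finset.sum_eq_single_of_mem i hi fun j _ hj => hz j hj, hnM]
    · exact Finset.sum_eq_zero fun j hj => hz j fun h => hi (h ▸ hj)
  obtain ⟨a, ha, h⟩ := exists_int_coeff_specialize_ne_zero hk hl
    (fun _ => (Finset.Icc (-(M : ℤ)) M).erase 0) fun i => by
      rw [Finset.card_erase_of_mem (by simp), Int.card_Icc]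
      have h1 := hle k i
      have h2 := hle l i
      have h3 : ¬ (M ≤ (part F J k).degreeOf i ∧ M ≤ (part F J l).degreeOf i) := fun h =>
        hkl ((htop k i h.1).trans (htop l i h.2).symm)
      omega
  refine ⟨a, fun i => ?_, h⟩
  have := ha i
  rw [Finset.mem_erase, Finset.mem_Icc] at this
  exact ⟨this.1, abs_le.mpr this.2⟩

/-- At signs only the parities of the exponents matter. Reducing exponents mod `2` keeps the
monomials distinct by `hodd`, and the resulting nonzero polynomial, of degree at most `1` in each
variable, cannot vanish on `{1, -1}^σ`. -/
theorem exists_sign_sum_ne_zero [CharZero K]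
    {S : Finset (σ →₀ ℕ)} (hS : S.Nonempty) {c : (σ →₀ ℕ) → K}
    (hc : ∀ n ∈ S, c n ≠ 0) (hodd : ∀ n ∈ S, ∀ n' ∈ S, n ≠ n' → ∃ i, Odd (n i + n' i)) :
    ∃ a : σ → ℤ, (∀ i, a i = 1 ∨ a i = -1) ∧ ∑ n ∈ S, c n * ∏ i, (a i : K) ^ n i ≠ 0 := by
  classical
  let r (n : σ →₀ ℕ) : σ →₀ ℕ := n.mapRange (· % 2) rfl
  have hr (n : σ →₀ ℕ) (i : σ) : r n i = n i % 2 := rfl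
  have hinj : ∀ n ∈ S, ∀ n' ∈ S, r n = r n' → n = n' := by
    intro n hn n' hn' h
    by_contra hne
    obtain ⟨i, hi⟩ := hodd n hn n' hn' hne
    have := DFunLike.congr_fun h i
    rw [hr, hr] at this
    rw [Nat.odd_iff] at hi
    omega
  set P : MvPolynomial σ K := ∑ n ∈ S, MvPolynomial.monomial (r n) (c n) with hP
  obtain ⟨n₀, hn₀⟩ := hS
  have hP0 : P ≠ 0 := by
    intro h
    have h2 : P.coeff (r n₀) = c n₀ := by
      rw [hP, MvPolynomial.coeff_sum, Finset.sum_eq_single_of_mem n₀ hn₀]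
      · simp
      · intro n hn hne
        rw [MvPolynomial.coeff_monomial, if_neg fun h => hne (hinj n hn n₀ hn₀ h)]
    rw [h, MvPolynomial.coeff_zero] at h2
    exact hc n₀ hn₀ h2.symm
  obtain ⟨a, ha, h⟩ := exists_int_eval_ne_zero hP0 (fun _ => {1, -1}) fun i => by
    rw [Finset.card_pair (by norm_num), MvPolynomial.degreeOf_lt_iff two_pos]
    intro m hm
    obtain ⟨n, -, hn⟩ := Finset.mem_biUnion.mp (MvPolynomial.support_sum hm)
    rw [Finset.mem_singleton.mp (MvPolynomial.support_monomial_subset hn), hr]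
    exact Nat.mod_lt _ two_pos
  have ha' : ∀ i, a i = 1 ∨ a i = -1 := fun i => by simpa using ha i
  refine ⟨a, ha', ?_⟩
  convert h using 1
  rw [hP, map_sum]
  refine Finset.sum_congr rfl fun n _ => ?_
  rw [MvPolynomial.eval_monomial, Finsupp.prod_fintype _ _ fun _ => pow_zero _]
  congr 1
  refine Finset.prod_congr rfl fun i _ => ?_
  rw [hr]
  have h2 : (a i : K) ^ 2 = 1 := by rcases ha' i with h | h <;> simp [h]
  conv_lhs => rw [← Nat.div_add_mod (n i) 2, pow_add, pow_mul, h2, one_pow, one_mul]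

end Nonvanishing

/-! ### Combinatorics of exponents and lower bounds for heights -/

section Exponents

variable {σ : Type*} [Fintype σ]

theorem exists_add_single_eq {n n' : σ →₀ ℕ} (hsum : ∑ i, n i = ∑ i, n' i)
    (hdist : ∑ i, (n i - n' i) ≤ 1) {p : σ} (hp : n' p < n p) :
    n p = n' p + 1 ∧ ∃ i, i ≠ p ∧ n + Finsupp.single i 1 = n' + Finsupp.single p 1 := by
  classical
  have hsplit : ∑ i, (n i - n' i) + ∑ i, n' i = ∑ i, (n' i - n i) + ∑ i, n i := by
    rw [← Finset.sum_add_distrib, ← Finset.sum_add_distrib]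
    exact Finset.sum_congr rfl fun i _ => by omega
  have h1 : n p - n' p ≤ ∑ i, (n i - n' i) :=
    Finset.single_le_sum (f := fun i => n i - n' i) (fun _ _ => Nat.zero_le _) (Finset.mem_univ p)
  have hone : ∑ i, (n i - n' i) = 1 := by omega
  have hone' : ∑ i, (n' i - n i) = 1 := by omega
  obtain ⟨p', hp'⟩ : ∃ a, n - n' = Finsupp.single a 1 :=
    (Finsupp.sum_eq_one_iff _).mp (by rwa [Finsupp.sum_fintype _ _ fun _ => rfl])
  obtain ⟨i, hi⟩ : ∃ a, n' - n = Finsupp.single a 1 :=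
    (Finsupp.sum_eq_one_iff _).mp (by rwa [Finsupp.sum_fintype _ _ fun _ => rfl])
  have e1 (j : σ) : n j - n' j = if p' = j then 1 else 0 := by
    have := DFunLike.congr_fun hp' j
    rwa [Finsupp.tsub_apply, Finsupp.single_apply] at this
  have e2 (j : σ) : n' j - n j = if i = j then 1 else 0 := by
    have := DFunLike.congr_fun hi j
    rwa [Finsupp.tsub_apply, Finsupp.single_apply] at this
  have hpp : p' = p := by
    by_contra h
    have := e1 p
    rw [if_neg h] at this
    omega
  subst hpp
  have hip : i ≠ p' := by
    rintro rfl
    have := e2 i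
    rw [if_pos rfl] at this
    omega
  refine ⟨by omega, i, hip, Finsupp.ext fun j => ?_⟩
  have h1 := e1 j
  have h2 := e2 j
  simp only [Finsupp.add_apply, Finsupp.single_apply]
  split_ifs at * <;> omega

/-- The left side consists of distinct terms of the multinomial expansion of the right, where all
coefficients are at least `1`. -/
theorem sum_prod_pow_le_sum_pow {S : Finset (σ →₀ ℕ)} (I : Finset σ) (d : ℕ) {x : σ → ℝ}
    (hx : ∀ i, 0 ≤ x i) (hS : ∀ n ∈ S, ∑ i ∈ I, n i = d)
    (hinj : ∀ n ∈ S, ∀ n' ∈ S, (∀ i ∈ I, n i = n' i) → n = n') :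
    ∑ n ∈ S, ∏ i ∈ I, x i ^ n i ≤ (∑ i ∈ I, x i) ^ d := by
  classical
  let r (n : σ →₀ ℕ) : σ → ℕ := fun i => if i ∈ I then n i else 0
  rw [Finset.sum_pow_eq_sum_piAntidiag]
  calc ∑ n ∈ S, ∏ i ∈ I, x i ^ n i = ∑ n ∈ S, ∏ i ∈ I, x i ^ r n i :=
        Finset.sum_congr rfl fun n _ => Finset.prod_congr rfl fun i hi => by simp [r, hi]
    _ = ∑ k ∈ S.image r, ∏ i ∈ I, x i ^ k i := by
        rw [Finset.sum_image]
        intro n hn n' hn' h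
        refine hinj n hn n' hn' fun i hi => ?_
        simpa [r, hi] using congrFun h i
    _ ≤ ∑ k ∈ I.piAntidiag d, ∏ i ∈ I, x i ^ k i := by
        refine Finset.sum_le_sum_of_subset_of_nonneg (fun k hk => ?_) fun k _ _ =>
          Finset.prod_nonneg fun i _ => pow_nonneg (hx i) _
        obtain ⟨n, hn, rfl⟩ := Finset.mem_image.mp hk
        rw [Finset.mem_piAntidiag]
        refine ⟨?_, fun i hi => ?_⟩
        · rw [← hS n hn]
          exact Finset.sum_congr rfl fun i hi => by simp [r, hi]
        · by_contra h
          simp [r, h] at hi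
    _ ≤ _ := by
        refine Finset.sum_le_sum fun k _ => le_mul_of_one_le_left
          (Finset.prod_nonneg fun i _ => pow_nonneg (hx i) _) ?_
        exact_mod_cast Nat.multinomial_pos I k

end Exponents

theorem algHeight_nonneg {ι : Type*} [Fintype ι] (z : ι → AlgebraicClosure ℚ) :
    0 ≤ algHeight z :=
  have := coordField_numberField z
  height_nonneg _

theorem sqrt_card_support_le_polyHeight {K σ : Type*} [Field K] [NumberField K]
    {F : MvPolynomial σ K} (hF : F ≠ 0) :
    √(F.support.card) ≤ polyHeight F := by
  have : Nonempty F.support := (MvPolynomial.support_nonempty.mpr hF).to_subtype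
  have := sqrt_card_le_height (x := fun n : F.support => F.coeff n)
    fun n => MvPolynomial.mem_support_iff.mp n.2
  rwa [Fintype.card_coe] at this

theorem sum_sq_le {σ : Type*} [Fintype σ] {a : σ → ℤ} {s : ℕ} (ha : ∀ i, |a i| ≤ s) {I : Finset σ}
    (hI : I.card < Fintype.card σ) :
    ∑ i ∈ I, (a i : ℝ) ^ 2 ≤ (s : ℝ) ^ 2 * ((Fintype.card σ : ℝ) - 1) := by
  have h1 (i : σ) : (a i : ℝ) ^ 2 ≤ (s : ℝ) ^ 2 := by
    rw [← sq_abs]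
    have : |(a i : ℝ)| ≤ s := by exact_mod_cast ha i
    gcongr
  have h2 : (I.card : ℝ) ≤ Fintype.card σ - 1 := by
    have : (I.card : ℝ) + 1 ≤ Fintype.card σ := by exact_mod_cast hI
    linarith
  refine (Finset.sum_le_card_nsmul _ _ _ fun i _ => h1 i).trans ?_
  rw [nsmul_eq_mul, mul_comm]
  gcongr

/-! ### The estimate when the specialization has spread at least two -/

section Bounds

variable {K : Type*} [Field K] [NumberField K] [Algebra K (AlgebraicClosure ℚ)]
  {σ : Type*} [Fintype σ] [DecidableEq σ]

/-- The bound obtained when the specialization has two terms whose degrees differ by at least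
two. -/
theorem exists_zero_of_spread {F : MvPolynomial σ K} (J : Finset σ) (a : σ → ℤ) {s k l : ℕ}
    (ha : ∀ i, a i ≠ 0 ∧ |a i| ≤ s) (hkl : l + 2 ≤ k)
    (hk : (specialize F J a).coeff k ≠ 0) (hl : (specialize F J a).coeff l ≠ 0)
    (hJ : J.Nonempty) (hJc : Jᶜ.Nonempty) (hs : 1 ≤ s) :
    ∃ z : σ → AlgebraicClosure ℚ, degOver K z ≤ F.totalDegree ∧ MvPolynomial.aeval z F = 0 ∧
      (∀ i, z i ≠ 0) ∧
      algHeight z ≤ √2 * (s * √((Fintype.card σ : ℝ) - 1)) * (√((s : ℝ) ^ F.totalDegree) *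
        polyHeight F) := by
  set G := specialize F J a with hG
  have hF : F ≠ 0 := by
    rintro rfl
    simp [hG, specialize] at hk
  obtain ⟨m, hm⟩ : ∃ m, G.natDegree = G.natTrailingDegree + m :=
    Nat.exists_eq_add_of_le G.natTrailingDegree_le_natDegree
  have hm2 : 2 ≤ m := by
    have := le_natDegree_of_ne_zero hk
    have := natTrailingDegree_le_of_ne_zero hl
    omega
  have hs' : (1 : ℝ) ≤ s := by exact_mod_cast hs
  have hH := sqrt_card_support_le_polyHeight hF
  set T : ℝ := (F.support.card : ℝ) with hT
  have hT1 : 1 ≤ T := by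
    rw [hT]
    exact_mod_cast Finset.card_pos.mpr (MvPolynomial.support_nonempty.mpr hF)
  have hH1 : 1 ≤ polyHeight F := (Real.one_le_sqrt.mpr hT1).trans hH
  set R : ℝ := (s : ℝ) ^ 2 * ((Fintype.card σ : ℝ) - 1) with hR
  have hcardJ : J.card < Fintype.card σ := by
    have := Finset.card_pos.mpr hJc
    have := Finset.card_compl_add_card J
    omega
  have hcardJc : Jᶜ.card < Fintype.card σ := by
    have := Finset.card_pos.mpr hJ
    have := Finset.card_compl_add_card J
    omega
  have hA := sum_sq_le (fun i => (ha i).2) hcardJc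
  have hB := sum_sq_le (fun i => (ha i).2) hcardJ
  have hA0 : 0 ≤ ∑ i ∈ Jᶜ, (a i : ℝ) ^ 2 := by positivity
  have hR0 : 0 ≤ R := hA0.trans hA
  have hterm (k : ℕ) : ∑ n ∈ partSupport F J k, ∏ i, ((a i : ℝ) ^ 2) ^ n i ≤
      T * (s ^ F.totalDegree) ^ 2 := by
    have h1 : ∀ n ∈ partSupport F J k, ∏ i, ((a i : ℝ) ^ 2) ^ n i ≤ (s ^ F.totalDegree) ^ 2 := by
      intro n hn
      calc ∏ i, ((a i : ℝ) ^ 2) ^ n i ≤ ∏ i, ((s : ℝ) ^ 2) ^ n i := by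
            refine Finset.prod_le_prod (fun i _ => by positivity) fun i _ => ?_
            rw [← sq_abs]
            have : |(a i : ℝ)| ≤ s := by exact_mod_cast (ha i).2
            gcongr
        _ = ((s : ℝ) ^ 2) ^ ∑ i, n i := Finset.prod_pow_eq_pow_sum _ _ _
        _ ≤ ((s : ℝ) ^ 2) ^ F.totalDegree :=
            pow_le_pow_right₀ (one_le_pow₀ hs') (sum_le_totalDegree (mem_partSupport.mp hn).1)
        _ = (s ^ F.totalDegree) ^ 2 := by rw [← pow_mul, ← pow_mul, mul_comm]
    refine (Finset.sum_le_card_nsmul _ _ _ h1).trans ?_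
    rw [nsmul_eq_mul]
    gcongr
    rw [hT]
    exact_mod_cast Finset.card_le_card (Finset.filter_subset _ _)
  obtain ⟨z, hz1, hz2, hz3, hz4⟩ := exists_zero_of_specialize F J a (fun i => (ha i).1) rfl hm
    -- At most `T` monomials, each with squared value at most `s^(2 deg F)`; both weights `A` and
    -- `B` are at most `R`.
    (by omega) (W := T * (s ^ F.totalDegree) ^ 2 * R ^ m) hJ hJc fun k hk => by
      refine mul_le_mul (hterm _) ?_ (by positivity) (by positivity)
      calc _ ≤ R ^ k * R ^ (m - k) := by gcongr
        _ = R ^ m := by rw [← pow_add, Nat.add_sub_cancel' hk]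
  refine ⟨z, hz1, hz2, hz3, ?_⟩
  have hsqR : √R = s * √((Fintype.card σ : ℝ) - 1) := by
    rw [hR, Real.sqrt_mul (by positivity), Real.sqrt_sq (by positivity)]
  rw [← hsqR]
  refine (pow_le_pow_iff_left₀ (algHeight_nonneg z) (by positivity) (n := m) (by omega)).mp ?_
  refine hz4.trans ?_
  have hsqRm : √(R ^ m) = √R ^ m :=
    (Real.sqrt_eq_iff_mul_self_eq (by positivity) (by positivity)).mpr
      (by rw [← mul_pow, Real.mul_self_sqrt hR0])
  rw [Real.sqrt_mul (by positivity), Real.sqrt_mul (by positivity), Real.sqrt_sq (by positivity),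
    hsqRm, rootConst, if_neg (by omega)]
  calc √2 ^ m * (√T * s ^ F.totalDegree * √R ^ m) * polyHeight F
      = (√2 * √R) ^ m * (s ^ F.totalDegree * (√T * polyHeight F)) := by ring
    _ ≤ (√2 * √R) ^ m * (s ^ F.totalDegree * (polyHeight F * polyHeight F)) := by gcongr
    _ = (√2 * √R) ^ m * (√((s : ℝ) ^ F.totalDegree) * polyHeight F) ^ 2 := by
        rw [mul_pow (√((s : ℝ) ^ F.totalDegree)), Real.sq_sqrt (by positivity), ← sq]
    -- This is where `m ≥ 2` enters: the squared base is at least `1`, so the exponent may be raised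
    -- to `m`.
    _ ≤ (√2 * √R) ^ m * (√((s : ℝ) ^ F.totalDegree) * polyHeight F) ^ m := by
        gcongr
        exact one_le_mul_of_one_le_of_one_le (Real.one_le_sqrt.mpr (one_le_pow₀ hs')) hH1
    _ = _ := by rw [← mul_pow]

end Bounds

theorem exists_sign_coeff_specialize_ne_zero {K σ : Type*} [Field K] [CharZero K]
    [Fintype σ] {F : MvPolynomial σ K} {J : Finset σ} {k l : ℕ}
    (hk : (partSupport F J k).card = 1) (hl : (partSupport F J l).Nonempty)
    (hodd : ∀ n ∈ partSupport F J l, ∀ n' ∈ partSupport F J l, n ≠ n' → ∃ i, Odd (n i + n' i)) :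
    ∃ a : σ → ℤ, (∀ i, a i = 1 ∨ a i = -1) ∧ (specialize F J a).coeff k ≠ 0 ∧
      (specialize F J a).coeff l ≠ 0 := by
  obtain ⟨a, ha, h⟩ := exists_sign_sum_ne_zero hl
    (fun n hn => MvPolynomial.mem_support_iff.mp (mem_partSupport.mp hn).1) hodd
  refine ⟨a, ha, ?_, by rwa [coeff_specialize]⟩
  obtain ⟨n, hn⟩ := Finset.card_eq_one.mp hk
  have hn' : n ∈ partSupport F J k := hn ▸ Finset.mem_singleton_self n
  rw [coeff_specialize, hn, Finset.sum_singleton]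
  refine mul_ne_zero (MvPolynomial.mem_support_iff.mp (mem_partSupport.mp hn').1)
    (Finset.prod_ne_zero_iff.mpr fun i _ => pow_ne_zero _ ?_)
  rcases ha i with h | h <;> simp [h]

/-! ### The cases of the proposition -/

section Cases

variable {K : Type*} [Field K] [NumberField K] [Algebra K (AlgebraicClosure ℚ)]
  {σ : Type*} [Fintype σ] [DecidableEq σ]

theorem exists_zero_of_not_homogeneous {F : MvPolynomial σ K} (hN : 2 ≤ Fintype.card σ)
    {n n' : σ →₀ ℕ} (hn : n ∈ F.support) (hn' : n' ∈ F.support) (hne : ∑ i, n i ≠ ∑ i, n' i) :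
    ∃ z : σ → AlgebraicClosure ℚ, degOver K z ≤ F.totalDegree ∧ MvPolynomial.aeval z F = 0 ∧
      (∀ i, z i ≠ 0) ∧ algHeight z ≤ (F.totalDegree : ℝ) ^ F.totalDegree *
        √((Fintype.card σ : ℝ) - 1) * polyHeight F := by
  have : Nonempty σ := Fintype.card_pos_iff.mp (by omega)
  set M := F.totalDegree with hM
  have hM0 : 0 < M := by
    have h1 := sum_le_totalDegree hn
    have h2 := sum_le_totalDegree hn'
    omega
  obtain ⟨a, ha, hk, hl⟩ := exists_bounded_coeff_specialize_ne_zero (J := Finset.univ) hM.le hM0 hne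
    ⟨n, mem_partSupport.mpr ⟨hn, rfl⟩⟩ ⟨n', mem_partSupport.mpr ⟨hn', rfl⟩⟩
  obtain ⟨z, hz1, hz2, hz3, hz4⟩ := exists_zero_on_line F a (fun i => (ha i).1) (by
    have h1 := natTrailingDegree_le_of_ne_zero hk
    have h2 := natTrailingDegree_le_of_ne_zero hl
    have h3 := le_natDegree_of_ne_zero hk
    have h4 := le_natDegree_of_ne_zero hl
    omega)
  refine ⟨z, hz1, hz2, hz3, hz4.trans ?_⟩
  have hN' : (2 : ℝ) ≤ Fintype.card σ := by exact_mod_cast hN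
  have hF : F ≠ 0 := MvPolynomial.support_nonempty.mp ⟨n, hn⟩
  have hcard : (2 : ℝ) ≤ F.support.card := by
    exact_mod_cast Finset.one_lt_card.mpr ⟨n, hn, n', hn', fun h => hne (by rw [h])⟩
  have hH : √2 ≤ polyHeight F :=
    (Real.sqrt_le_sqrt hcard).trans (sqrt_card_support_le_polyHeight hF)
  -- With at least two variables, `N ≤ 2(N - 1)`; the resulting `√2` is absorbed by `H(F) ≥ √2`.
  have hsum : ∑ i, (a i : ℝ) ^ 2 ≤ (M : ℝ) ^ 2 * (((Fintype.card σ : ℝ) - 1) * 2) := by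
    have h1 : ∑ i, (a i : ℝ) ^ 2 ≤ (M : ℝ) ^ 2 * Fintype.card σ := by
      refine (Finset.sum_le_card_nsmul _ _ ((M : ℝ) ^ 2) fun i _ => ?_).trans (le_of_eq ?_)
      · rw [← sq_abs]
        have : |(a i : ℝ)| ≤ M := by exact_mod_cast (ha i).2
        gcongr
      · rw [nsmul_eq_mul, mul_comm, Finset.card_univ]
    refine h1.trans ?_
    gcongr
    linarith
  refine (Real.sqrt_le_sqrt hsum).trans ?_
  rw [Real.sqrt_mul (by positivity), Real.sqrt_sq (by positivity), Real.sqrt_mul (by linarith),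
    ← mul_assoc]
  have hMM : (M : ℝ) ≤ (M : ℝ) ^ M := le_self_pow₀ (by exact_mod_cast hM0) hM0.ne'
  gcongr

/-- The case of a homogeneous polynomial any two of whose monomials differ by the replacement of
one variable by another one. -/
theorem exists_zero_of_adjacent {F : MvPolynomial σ K} {M : ℕ}
    (hhom : ∀ n ∈ F.support, ∑ i, n i = M)
    (hadj : ∀ n ∈ F.support, ∀ n' ∈ F.support, ∑ i, (n i - n' i) ≤ 1)
    {n₁ n₀ : σ →₀ ℕ} (hn₁ : n₁ ∈ F.support) (hn₀ : n₀ ∈ F.support) (hne : n₁ ≠ n₀) :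
    ∃ z : σ → AlgebraicClosure ℚ, degOver K z ≤ F.totalDegree ∧ MvPolynomial.aeval z F = 0 ∧
      (∀ i, z i ≠ 0) ∧ algHeight z ≤ √(M * ((Fintype.card σ : ℝ) - 1)) * polyHeight F := by
  obtain ⟨p, hp⟩ : ∃ p, n₀ p < n₁ p := by
    by_contra! h
    refine hne (Finsupp.ext fun i => ?_)
    exact (Finset.sum_eq_sum_iff_of_le fun i _ => h i).mp ((hhom n₁ hn₁).trans (hhom n₀ hn₀).symm)
      i (Finset.mem_univ i)
  have : Nonempty σ := ⟨p⟩
  set e := n₀ p with he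
  have hdiff (n n' : σ →₀ ℕ) (hn : n ∈ F.support) (hn' : n' ∈ F.support) : n p ≤ n' p + 1 := by
    have := (Finset.single_le_sum (f := fun i => n i - n' i) (fun _ _ => Nat.zero_le _)
      (Finset.mem_univ p)).trans (hadj n hn n' hn')
    omega
  have hrange : ∀ n ∈ F.support, n p = e ∨ n p = e + 1 := by
    intro n hn
    have h1 := hdiff n n₀ hn hn₀
    have h2 := hdiff n₁ n hn₁ hn
    omega
  have hmem {n : σ →₀ ℕ} {k : ℕ} : n ∈ partSupport F {p} k ↔ n ∈ F.support ∧ n p = k := by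
    rw [mem_partSupport, Finset.sum_singleton]
  have hstep : ∀ n ∈ partSupport F {p} (e + 1), ∀ n' ∈ partSupport F {p} e,
      ∃ i, i ≠ p ∧ n + Finsupp.single i 1 = n' + Finsupp.single p 1 := by
    intro n hn n' hn'
    rw [hmem] at hn hn'
    exact (exists_add_single_eq ((hhom n hn.1).trans (hhom n' hn'.1).symm) (hadj n hn.1 n' hn'.1)
      (p := p) (by omega)).2
  have hmem₁ : n₁ ∈ partSupport F {p} (e + 1) := by
    rw [hmem]
    exact ⟨hn₁, by have := hrange n₁ hn₁; omega⟩
  have hmem₀ : n₀ ∈ partSupport F {p} e := hmem.mpr ⟨hn₀, rfl⟩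
  have hcoord {n n' : σ →₀ ℕ} {i : σ} (h : n + Finsupp.single i 1 = n' + Finsupp.single p 1)
      (j : σ) : n j + (if i = j then 1 else 0) = n' j + (if p = j then 1 else 0) := by
    simpa only [Finsupp.add_apply, Finsupp.single_apply] using DFunLike.congr_fun h j
  -- Each such monomial arises from `n₀` by trading a variable occurring in `n₀` for `X_p`, and at
  -- most `M` variables occur there.
  have hcard₁ : (partSupport F {p} (e + 1)).card ≤ M := by
    choose! f hf using fun n hn => hstep n hn n₀ hmem₀
    calc _ ≤ n₀.support.card := by
          refine Finset.card_le_card_of_injOn f (fun n hn => ?_) fun n hn n' hn' h => ?_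
          · obtain ⟨h1, h2⟩ := hf n hn
            have := hcoord h2 (f n)
            rw [if_pos rfl, if_neg h1.symm] at this
            rw [Finset.mem_coe, Finsupp.mem_support_iff]
            omega
          · have h1 := (hf n hn).2
            have h2 := (hf n' hn').2
            rw [h, ← h2] at h1
            exact add_right_cancel h1
      _ ≤ ∑ i ∈ n₀.support, n₀ i := by
          rw [Finset.card_eq_sum_ones]
          exact Finset.sum_le_sum fun i hi => Nat.one_le_iff_ne_zero.mpr
            (Finsupp.mem_support_iff.mp hi)
      _ ≤ ∑ i, n₀ i := Finset.sum_le_sum_of_subset (Finset.subset_univ _)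
      _ = M := hhom n₀ hn₀
  have hcard₀ : (partSupport F {p} e).card ≤ Fintype.card σ - 1 := by
    choose! f hf using fun n' hn' => hstep n₁ hmem₁ n' hn'
    calc _ ≤ (Finset.univ.erase p).card := by
          refine Finset.card_le_card_of_injOn f (fun n hn => ?_) fun n hn n' hn' h => ?_
          · simpa using (hf n hn).1
          · have h1 := (hf n hn).2
            have h2 := (hf n' hn').2
            rw [h, h2] at h1
            exact (add_right_cancel h1).symm
      _ = Fintype.card σ - 1 := by rw [Finset.card_erase_of_mem (Finset.mem_univ p),
          Finset.card_univ]
  -- With two monomials in each part, the four exchange relations contradict one another in the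
  -- coordinate `i₁₁`. The singleton part survives any choice of signs, so only the other part
  -- constrains `a`.
  have hsingle : (partSupport F {p} (e + 1)).card = 1 ∨ (partSupport F {p} e).card = 1 := by
    by_contra! h
    have h1 := Finset.card_pos.mpr ⟨n₁, hmem₁⟩
    have h0 := Finset.card_pos.mpr ⟨n₀, hmem₀⟩
    obtain ⟨m₁, hm₁, m₂, hm₂, hm⟩ := Finset.one_lt_card.mp (lt_of_le_of_ne h1 h.1.symm)
    obtain ⟨r₁, hr₁, r₂, hr₂, hr⟩ := Finset.one_lt_card.mp (lt_of_le_of_ne h0 h.2.symm)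
    obtain ⟨i₁₁, -, h₁₁⟩ := hstep m₁ hm₁ r₁ hr₁
    obtain ⟨i₁₂, -, h₁₂⟩ := hstep m₁ hm₁ r₂ hr₂
    obtain ⟨i₂₁, -, h₂₁⟩ := hstep m₂ hm₂ r₁ hr₁
    obtain ⟨i₂₂, -, h₂₂⟩ := hstep m₂ hm₂ r₂ hr₂
    have hi : i₁₁ ≠ i₂₁ := by
      rintro rfl
      exact hm (add_right_cancel (h₁₁.trans h₂₁.symm))
    have hj : i₁₁ ≠ i₁₂ := by
      rintro rfl
      exact hr (add_right_cancel (h₁₁.symm.trans h₁₂))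
    have c₁ := hcoord h₁₁ i₁₁
    have c₂ := hcoord h₁₂ i₁₁
    have c₃ := hcoord h₂₁ i₁₁
    have c₄ := hcoord h₂₂ i₁₁
    rw [if_pos rfl] at c₁
    rw [if_neg hj.symm] at c₂
    rw [if_neg hi.symm] at c₃
    split_ifs at * <;> omega
  obtain ⟨a, ha, hc₁, hc₀⟩ : ∃ a : σ → ℤ, (∀ i, a i = 1 ∨ a i = -1) ∧
      (specialize F {p} a).coeff (e + 1) ≠ 0 ∧ (specialize F {p} a).coeff e ≠ 0 := by
    rcases hsingle with h | h
    · refine exists_sign_coeff_specialize_ne_zero h ⟨n₀, hmem₀⟩ fun n hn n' hn' hnn => ?_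
      obtain ⟨i, hi, h1⟩ := hstep n₁ hmem₁ n hn
      obtain ⟨j, hj, h2⟩ := hstep n₁ hmem₁ n' hn'
      have hij : i ≠ j := by
        rintro rfl
        exact hnn (add_right_cancel (h1.symm.trans h2))
      refine ⟨i, ?_⟩
      have c₁ := hcoord h1 i
      have c₂ := hcoord h2 i
      rw [if_pos rfl, if_neg hi.symm] at c₁
      rw [if_neg hij.symm, if_neg hi.symm] at c₂
      exact ⟨n₁ i, by omega⟩
    · obtain ⟨a, ha, h1, h2⟩ := exists_sign_coeff_specialize_ne_zero h ⟨n₁, hmem₁⟩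
        fun n hn n' hn' hnn => by
          obtain ⟨i, hi, h1⟩ := hstep n hn n₀ hmem₀
          obtain ⟨j, hj, h2⟩ := hstep n' hn' n₀ hmem₀
          have hij : i ≠ j := by
            rintro rfl
            exact hnn (add_right_cancel (h1.trans h2.symm))
          refine ⟨i, ?_⟩
          have c₁ := hcoord h1 i
          have c₂ := hcoord h2 i
          rw [if_pos rfl, if_neg hi.symm] at c₁
          rw [if_neg hij.symm, if_neg hi.symm] at c₂
          exact ⟨n i, by omega⟩
      exact ⟨a, ha, h2, h1⟩
  have hempty {k : ℕ} (hk : k ≠ e) (hk' : k ≠ e + 1) : (specialize F {p} a).coeff k = 0 := by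
    rw [coeff_specialize, Finset.sum_eq_zero]
    intro n hn
    rw [hmem] at hn
    have := hrange n hn.1
    omega
  have hdeg : (specialize F {p} a).natDegree = e + 1 := by
    refine le_antisymm (natDegree_le_iff_coeff_eq_zero.mpr fun k hk => hempty (by omega)
      (by omega)) (le_natDegree_of_ne_zero hc₁)
  have htrail : (specialize F {p} a).natTrailingDegree = e := by
    refine le_antisymm (natTrailingDegree_le_of_ne_zero hc₀)
      (le_natTrailingDegree (fun h => hc₀ (by rw [h, coeff_zero])) fun k hk =>
        hempty (by omega) (by omega))
  have hsq (i : σ) : (a i : ℝ) ^ 2 = 1 := by rcases ha i with h | h <;> simp [h]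
  obtain ⟨i₀, hi₀, -⟩ := hstep n₁ hmem₁ n₀ hmem₀
  have hcard : ((({p} : Finset σ)ᶜ).card : ℝ) = (Fintype.card σ : ℝ) - 1 := by
    rw [Finset.card_compl, Finset.card_singleton, Nat.cast_sub (Fintype.card_pos_iff.mpr ⟨p⟩),
      Nat.cast_one]
  have hcard0 : (0 : ℝ) ≤ (Fintype.card σ : ℝ) - 1 := hcard ▸ Nat.cast_nonneg _
  have hM1 : (1 : ℝ) ≤ M := by
    exact_mod_cast (Finset.card_pos.mpr ⟨n₁, hmem₁⟩).trans_le hcard₁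
  obtain ⟨z, hz1, hz2, hz3, hz4⟩ := exists_zero_of_specialize F {p} a
    (fun i => by rcases ha i with h | h <;> simp [h]) htrail hdeg one_ne_zero
    -- With signs, `A = N - 1` and `B = 1`: the constant coefficient needs the bound `N - 1` and the
    -- linear one needs `M (N - 1)`.
    (W := M * ((Fintype.card σ : ℝ) - 1)) ⟨p, by simp⟩ ⟨i₀, by simpa using hi₀⟩ fun k hk => by
      simp only [hsq, one_pow, Finset.prod_const_one, Finset.sum_const, nsmul_eq_mul, mul_one,
        Finset.card_singleton, Nat.cast_one, hcard]
      interval_cases k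
      · rw [pow_zero, mul_one, zero_add]
        have h1 : ((partSupport F {p} e).card : ℝ) ≤ (Fintype.card σ : ℝ) - 1 := by
          rw [← hcard, Finset.card_compl, Finset.card_singleton]
          exact_mod_cast hcard₀
        exact h1.trans (le_mul_of_one_le_left hcard0 hM1)
      · rw [pow_one, add_comm 1 e]
        have h1 : ((partSupport F {p} (e + 1)).card : ℝ) ≤ M := by exact_mod_cast hcard₁
        exact mul_le_mul_of_nonneg_right h1 hcard0
  refine ⟨z, hz1, hz2, hz3, ?_⟩
  rwa [pow_one, rootConst, if_pos rfl, one_mul] at hz4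

theorem exists_partition_of_spread {n n' : σ →₀ ℕ} (hsum : ∑ i, n i = ∑ i, n' i)
    (hdist : 2 ≤ ∑ i, (n i - n' i)) :
    ∃ J : Finset σ, J.Nonempty ∧ Jᶜ.Nonempty ∧ ∑ i ∈ J, n' i + 2 ≤ ∑ i ∈ J, n i := by
  -- On this set the degree gap is the whole distance between the exponents; equality of total
  -- degrees keeps it from being everything.
  set J : Finset σ := {i | n' i < n i} with hJ
  have h1 : ∑ i ∈ J, (n i - n' i) = ∑ i, (n i - n' i) := by
    refine Finset.sum_subset (Finset.subset_univ _) fun i _ hi => ?_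
    simp only [hJ, Finset.mem_filter, Finset.mem_univ, true_and] at hi
    omega
  have h2 : ∑ i ∈ J, (n i - n' i) + ∑ i ∈ J, n' i = ∑ i ∈ J, n i := by
    rw [← Finset.sum_add_distrib]
    refine Finset.sum_congr rfl fun i hi => ?_
    simp only [hJ, Finset.mem_filter, Finset.mem_univ, true_and] at hi
    omega
  refine ⟨J, ?_, ?_, by omega⟩
  · rw [Finset.nonempty_iff_ne_empty]
    intro h
    rw [h, Finset.sum_empty] at h1
    omega
  · rw [Finset.nonempty_iff_ne_empty, Ne, Finset.compl_eq_empty_iff]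
    intro h
    rw [h] at h2
    omega

theorem exists_zero_of_three_le {F : MvPolynomial σ K} {M : ℕ} (hM : F.totalDegree = M)
    (hM3 : 3 ≤ M) {n n' : σ →₀ ℕ} (hn : n ∈ F.support)
    (hn' : n' ∈ F.support) (hsum : ∑ i, n i = ∑ i, n' i) (hdist : 2 ≤ ∑ i, (n i - n' i)) :
    ∃ z : σ → AlgebraicClosure ℚ, degOver K z ≤ F.totalDegree ∧ MvPolynomial.aeval z F = 0 ∧
      (∀ i, z i ≠ 0) ∧ algHeight z ≤ (M : ℝ) ^ M * √((Fintype.card σ : ℝ) - 1) * polyHeight F := by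
  obtain ⟨J, hJ, hJc, hspread⟩ := exists_partition_of_spread hsum hdist
  obtain ⟨a, ha, hk, hl⟩ := exists_bounded_coeff_specialize_ne_zero hM.le (by omega)
    (show ∑ i ∈ J, n i ≠ ∑ i ∈ J, n' i by omega)
    ⟨n, mem_partSupport.mpr ⟨hn, rfl⟩⟩ ⟨n', mem_partSupport.mpr ⟨hn', rfl⟩⟩
  obtain ⟨z, hz1, hz2, hz3, hz4⟩ := exists_zero_of_spread J a ha hspread hk hl hJ hJc (by omega)
  refine ⟨z, hz1, hz2, hz3, hz4.trans ?_⟩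
  rw [hM]
  have hMr : (3 : ℝ) ≤ M := by exact_mod_cast hM3
  -- Equivalent to `2 M² ≤ M^M`, which fails for `M = 2` and forces the separate treatment of
  -- quadratic forms.
  have hconst : √2 * M * √((M : ℝ) ^ M) ≤ (M : ℝ) ^ M := by
    refine le_of_sq_le_sq ?_ (by positivity)
    rw [mul_pow, mul_pow, Real.sq_sqrt zero_le_two, Real.sq_sqrt (by positivity), sq ((M : ℝ) ^ M)]
    refine mul_le_mul_of_nonneg_right ?_ (by positivity)
    calc (2 : ℝ) * M ^ 2 ≤ M * M ^ 2 := by gcongr; linarith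
      _ = (M : ℝ) ^ 3 := by ring
      _ ≤ (M : ℝ) ^ M := pow_le_pow_right₀ (by linarith) hM3
  have hH : 0 ≤ polyHeight F := height_nonneg _
  calc √2 * (M * √((Fintype.card σ : ℝ) - 1)) * (√((M : ℝ) ^ M) * polyHeight F)
      = √2 * M * √((M : ℝ) ^ M) * √((Fintype.card σ : ℝ) - 1) * polyHeight F := by ring
    _ ≤ _ := by gcongr

theorem exists_zero_of_quadratic_squarefree {F : MvPolynomial σ K}
    (hhom : ∀ n ∈ F.support, ∑ i, n i = 2) (hsqf : ∀ n ∈ F.support, ∀ i, n i ≤ 1)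
    {n n' : σ →₀ ℕ} (hn : n ∈ F.support) (hn' : n' ∈ F.support)
    (hdist : 2 ≤ ∑ i, (n i - n' i)) :
    ∃ z : σ → AlgebraicClosure ℚ, degOver K z ≤ F.totalDegree ∧ MvPolynomial.aeval z F = 0 ∧
      (∀ i, z i ≠ 0) ∧
      algHeight z ≤ √2 * √((Fintype.card σ : ℝ) - 1) * polyHeight F := by
  obtain ⟨J, hJ, hJc, hspread⟩ :=
    exists_partition_of_spread ((hhom n hn).trans (hhom n' hn').symm) hdist
  have hJle (m : σ →₀ ℕ) : ∑ i ∈ J, m i ≤ ∑ i, m i :=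
    Finset.sum_le_sum_of_subset (Finset.subset_univ J)
  have hnJ : ∑ i ∈ J, n i = 2 := by
    have := hJle n
    rw [hhom n hn] at this
    omega
  have hnJ' : ∑ i ∈ J, n' i = 0 := by omega
  -- The two parts involve disjoint sets of variables and are squarefree, so their product has
  -- degree at most `1` in each variable and signs suffice.
  obtain ⟨a, ha, hk, hl⟩ := exists_int_coeff_specialize_ne_zero (F := F) (J := J) (k := 2) (l := 0)
    ⟨n, mem_partSupport.mpr ⟨hn, hnJ⟩⟩ ⟨n', mem_partSupport.mpr ⟨hn', hnJ'⟩⟩ (fun _ => {1, -1})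
    fun i => by
      rw [Finset.card_pair (by norm_num)]
      by_cases hi : i ∈ J
      · have h1 : (part F J 2).degreeOf i ≤ 1 := degreeOf_part_le fun m hm =>
          hsqf m (mem_partSupport.mp hm).1 i
        have h2 : (part F J 0).degreeOf i ≤ 0 := degreeOf_part_le fun m hm => by
          rw [← (mem_partSupport.mp hm).2]
          exact Finset.single_le_sum (f := m) (fun _ _ => Nat.zero_le _) hi
        omega
      · have h1 : (part F J 2).degreeOf i ≤ 0 := degreeOf_part_le fun m hm => by
          rw [mem_partSupport] at hm
          have h := hhom m hm.1
          rw [← Finset.sum_compl_add_sum J, hm.2] at h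
          have := Finset.single_le_sum (f := m) (fun _ _ => Nat.zero_le _)
            (Finset.mem_compl.mpr hi)
          omega
        have h2 : (part F J 0).degreeOf i ≤ 1 := degreeOf_part_le fun m hm =>
          hsqf m (mem_partSupport.mp hm).1 i
        omega
  obtain ⟨z, hz1, hz2, hz3, hz4⟩ := exists_zero_of_spread J a (s := 1)
    (fun i => by
      have : a i = 1 ∨ a i = -1 := by simpa using ha i
      rcases this with h | h <;> simp [h]) le_rfl hk hl hJ hJc le_rfl
  refine ⟨z, hz1, hz2, hz3, hz4.trans (le_of_eq ?_)⟩
  simp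

theorem exists_zero_of_quadratic_square {F : MvPolynomial σ K} (hM : F.totalDegree = 2)
    (hhom : ∀ n ∈ F.support, ∑ i, n i = 2) {n n₀ : σ →₀ ℕ} {j : σ} (hn : n ∈ F.support)
    (hnj : n j = 2) (hn₀ : n₀ ∈ F.support) (hnj₀ : n₀ j = 0) :
    ∃ z : σ → AlgebraicClosure ℚ, degOver K z ≤ F.totalDegree ∧ MvPolynomial.aeval z F = 0 ∧
      (∀ i, z i ≠ 0) ∧
      algHeight z ≤ 4 * √((Fintype.card σ : ℝ) - 1) * polyHeight F := by
  have hmem {m : σ →₀ ℕ} {k : ℕ} : m ∈ partSupport F {j} k ↔ m ∈ F.support ∧ m j = k := by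
    rw [mem_partSupport, Finset.sum_singleton]
  have hsplit (m : σ →₀ ℕ) (hm : m ∈ F.support) : ∑ i ∈ {j}ᶜ, m i + m j = 2 := by
    rw [← hhom m hm, ← Finset.sum_compl_add_sum {j}, Finset.sum_singleton]
  have hcompl (m : σ →₀ ℕ) (i : σ) (hi : i ≠ j) : m i ≤ ∑ i ∈ {j}ᶜ, m i :=
    Finset.single_le_sum (f := m) (fun _ _ => Nat.zero_le _) (by simpa using hi)
  obtain ⟨a, ha, hc₀⟩ := exists_int_eval_ne_zero
    (part_ne_zero (J := {j}) (k := 0) ⟨n₀, hmem.mpr ⟨hn₀, hnj₀⟩⟩)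
    -- The part free of `X_j` is quadratic in the other variables, hence three values each; the part
    -- of degree `2` is a multiple of `X_j²` and never vanishes.
    (fun i => if i = j then {1} else {1, -1, 2}) fun i => by
      split_ifs with hi
      · subst hi
        have h : (part F {i} 0).degreeOf i ≤ 0 :=
          degreeOf_part_le fun m hm => (hmem.mp hm).2.le
        simpa using h
      · have h : (part F {j} 0).degreeOf i ≤ 2 := degreeOf_part_le fun m hm => by
          have := hsplit m (hmem.mp hm).1
          have := hcompl m i hi
          omega
        have h3 : ({1, -1, 2} : Finset ℤ).card = 3 := rfl
        omega
  rw [eval_part] at hc₀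
  have haj : a j = 1 := by simpa using ha j
  have ha' (i : σ) : a i ≠ 0 ∧ |a i| ≤ (2 : ℕ) := by
    have := ha i
    split_ifs at this
    · simp only [Finset.mem_singleton] at this
      simp [this]
    · simp only [Finset.mem_insert, Finset.mem_singleton] at this
      rcases this with h | h | h <;> simp [h]
  have hpart₂ : ∀ m ∈ partSupport F {j} 2, m = n := by
    have h (m : σ →₀ ℕ) (hm : m ∈ F.support) (hmj : m j = 2) : m = Finsupp.single j 2 := by
      ext i
      rcases eq_or_ne j i with rfl | hi
      · simpa using hmj
      · have := hsplit m hm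
        have := hcompl m i hi.symm
        rw [Finsupp.single_eq_of_ne' hi]
        omega
    intro m hm
    rw [h m (hmem.mp hm).1 (hmem.mp hm).2, h n hn hnj]
  have hc₂ : (specialize F {j} a).coeff 2 ≠ 0 := by
    have : partSupport F {j} 2 = {n} := Finset.eq_singleton_iff_unique_mem.mpr
      ⟨hmem.mpr ⟨hn, hnj⟩, hpart₂⟩
    rw [coeff_specialize, this, Finset.sum_singleton]
    exact mul_ne_zero (MvPolynomial.mem_support_iff.mp hn)
      (Finset.prod_ne_zero_iff.mpr fun i _ => pow_ne_zero _ (by exact_mod_cast (ha' i).1))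
  have hdeg : (specialize F {j} a).natDegree = 0 + 2 :=
    le_antisymm ((natDegree_specialize_le F {j} a).trans hM.le) (le_natDegree_of_ne_zero hc₂)
  have htrail : (specialize F {j} a).natTrailingDegree = 0 :=
    Nat.le_zero.mp (natTrailingDegree_le_of_ne_zero hc₀)
  have hJc : (({j} : Finset σ)ᶜ).Nonempty := by
    rw [Finset.nonempty_iff_ne_empty]
    intro h
    have := hsplit n₀ hn₀
    rw [h, hnj₀] at this
    simp at this
  set A : ℝ := ∑ i ∈ {j}ᶜ, (a i : ℝ) ^ 2 with hA
  have hA0 : 0 ≤ A := by positivity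
  have hAle : A ≤ 4 * ((Fintype.card σ : ℝ) - 1) := by
    have := sum_sq_le (I := {j}ᶜ) (fun i => (ha' i).2) (by
      have := Finset.card_compl_add_card {j}
      rw [Finset.card_singleton] at this
      omega)
    norm_num at this
    exact this
  obtain ⟨z, hz1, hz2, hz3, hz4⟩ := exists_zero_of_specialize F {j} a (fun i => (ha' i).1) htrail
    -- Since `a_j = 1`, the weight `B` is `1`, and the multinomial estimate bounds the monomials of
    -- the `k`-th part by `A^(2-k)`; no factor for the number of monomials is lost.
    hdeg two_ne_zero (W := A ^ 2) ⟨j, by simp⟩ hJc fun k hk => by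
      rw [Finset.sum_singleton, haj, Int.cast_one, one_pow, one_pow, mul_one, add_zero]
      have h1 : ∑ m ∈ partSupport F {j} k, ∏ i, ((a i : ℝ) ^ 2) ^ m i ≤ A ^ (2 - k) := by
        refine le_trans (le_of_eq (Finset.sum_congr rfl fun m _ => ?_))
          (sum_prod_pow_le_sum_pow {j}ᶜ (2 - k) (x := fun i => (a i : ℝ) ^ 2)
            (S := partSupport F {j} k) (fun i => by positivity) (fun m hm => ?_)
            fun m hm m' hm' h => ?_)
        · rw [← Finset.prod_compl_mul_prod {j}, Finset.prod_singleton, haj]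
          simp
        · have := hsplit m (hmem.mp hm).1
          have := (hmem.mp hm).2
          omega
        · ext i
          rcases eq_or_ne i j with rfl | hi
          · rw [(hmem.mp hm).2, (hmem.mp hm').2]
          · exact h i (by simpa using hi)
      calc _ ≤ A ^ (2 - k) * A ^ k := by gcongr
        _ = A ^ 2 := by rw [← pow_add, Nat.sub_add_cancel hk]
  refine ⟨z, hz1, hz2, hz3, ?_⟩
  have hcard0 : 0 ≤ (Fintype.card σ : ℝ) - 1 := by linarith
  have hF : F ≠ 0 := MvPolynomial.support_nonempty.mp ⟨n, hn⟩
  have hH1 : 1 ≤ polyHeight F := by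
    refine le_trans (Real.one_le_sqrt.mpr ?_) (sqrt_card_support_le_polyHeight hF)
    exact_mod_cast Finset.card_pos.mpr ⟨n, hn⟩
  refine le_of_sq_le_sq (hz4.trans ?_) (by positivity)
  rw [rootConst, if_neg (by norm_num), Real.sq_sqrt zero_le_two, Real.sqrt_sq hA0, mul_pow, mul_pow,
    Real.sq_sqrt hcard0]
  nlinarith [mul_le_mul hAle hH1 zero_le_one (by positivity),
    mul_le_mul_of_nonneg_right hAle (zero_le_one.trans hH1),
    mul_nonneg hcard0 (mul_nonneg (zero_le_one.trans hH1) (sub_nonneg.mpr hH1))]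

end Cases

end PolyZeros

/-! ### Assembling the cases -/

open PolyZeros in
theorem proposition2 {K : Type*} [Field K] [NumberField K] [Algebra K (AlgebraicClosure ℚ)]
    (M N : ℕ) (hM : 1 ≤ M) (hN : 2 ≤ N) (F : MvPolynomial (Fin N) K)
    (hdeg : F.totalDegree = M)
    (hF : ¬ ∃ (m : Fin N →₀ ℕ) (c : K), F = MvPolynomial.monomial m c) :
    ∃ z : Fin N → AlgebraicClosure ℚ,
      PolyZeros.degOver K z ≤ M ∧
      MvPolynomial.aeval z F = 0 ∧
      (∀ i, z i ≠ 0) ∧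
      PolyZeros.algHeight z ≤ (M : ℝ) ^ M * √((N : ℝ) - 1) * PolyZeros.polyHeight F := by
  have hcard : Fintype.card (Fin N) = N := Fintype.card_fin N
  have hH : 0 ≤ polyHeight F := height_nonneg _
  have hMr : (1 : ℝ) ≤ M := by exact_mod_cast hM
  have hNr : (2 : ℝ) ≤ N := by exact_mod_cast hN
  obtain ⟨n₁, hn₁, n₀, hn₀, hne⟩ : ∃ n ∈ F.support, ∃ n' ∈ F.support, n ≠ n' := by
    by_contra! h
    rcases F.support.eq_empty_or_nonempty with h0 | ⟨n, hn⟩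
    · exact hF ⟨0, 0, by rw [MvPolynomial.support_eq_empty.mp h0, map_zero]⟩
    · refine hF ⟨n, F.coeff n, ?_⟩
      conv_lhs => rw [F.as_sum]
      exact Finset.sum_eq_single_of_mem n hn fun n' hn' h' => absurd (h n' hn' n hn) h'
  by_cases hhom : ∀ n ∈ F.support, ∀ n' ∈ F.support, ∑ i, n i = ∑ i, n' i
  swap
  · push Not at hhom
    obtain ⟨n, hn, n', hn', h⟩ := hhom
    have := exists_zero_of_not_homogeneous (by rwa [hcard]) hn hn' h
    rwa [hdeg, hcard] at this
  have hsum : ∀ n ∈ F.support, ∑ i, n i = M := by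
    intro n hn
    refine le_antisymm ((sum_le_totalDegree hn).trans hdeg.le) ?_
    rw [← hdeg]
    refine Finset.sup_le fun n' hn' => ?_
    rw [Finsupp.sum_fintype _ _ fun _ => rfl]
    exact (hhom n' hn' n hn).le
  by_cases hadj : ∀ n ∈ F.support, ∀ n' ∈ F.support, ∑ i, (n i - n' i) ≤ 1
  · obtain ⟨z, hz1, hz2, hz3, hz4⟩ := exists_zero_of_adjacent hsum hadj hn₁ hn₀ hne
    refine ⟨z, hz1.trans hdeg.le, hz2, hz3, hz4.trans ?_⟩
    rw [hcard, Real.sqrt_mul (by positivity)]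
    gcongr
    rw [Real.sqrt_le_left (by positivity)]
    have : (M : ℝ) ≤ (M : ℝ) ^ M := le_self_pow₀ hMr (by omega)
    nlinarith
  push Not at hadj
  obtain ⟨n, hn, n', hn', hdist⟩ := hadj
  have hM2 : 2 ≤ M := by
    rw [← hsum n hn]
    exact le_trans hdist (Finset.sum_le_sum fun i _ => Nat.sub_le _ _)
  rcases hM2.eq_or_lt with rfl | hM3
  · by_cases hsqf : ∀ n ∈ F.support, ∀ i, n i ≤ 1
    · obtain ⟨z, hz1, hz2, hz3, hz4⟩ :=
        exists_zero_of_quadratic_squarefree hsum hsqf hn hn' hdist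
      refine ⟨z, hz1.trans hdeg.le, hz2, hz3, hz4.trans ?_⟩
      rw [hcard]
      gcongr
      rw [Real.sqrt_le_left (by positivity)]
      norm_num
    · push Not at hsqf
      obtain ⟨m, hm, j, hj⟩ := hsqf
      have hmj : m j = 2 := by
        have := Finset.single_le_sum (f := m) (fun _ _ => Nat.zero_le _) (Finset.mem_univ j)
        rw [hsum m hm] at this
        omega
      -- If `X_j` divided every monomial, any two would share it and their distance would be at most
      -- `1`, against `hdist`.
      obtain ⟨m₀, hm₀, hmj₀⟩ : ∃ m₀ ∈ F.support, m₀ j = 0 := by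
        by_contra! h
        have h1 := hsum n hn
        have h2 := h n hn
        have h3 := h n' hn'
        rw [← Finset.add_sum_erase _ _ (Finset.mem_univ j)] at h1 hdist
        have h4 : ∑ i ∈ Finset.univ.erase j, (n i - n' i) ≤ ∑ i ∈ Finset.univ.erase j, n i :=
          Finset.sum_le_sum fun i _ => Nat.sub_le _ _
        omega
      obtain ⟨z, hz1, hz2, hz3, hz4⟩ :=
        exists_zero_of_quadratic_square hdeg hsum hm hmj hm₀ hmj₀
      refine ⟨z, hz1.trans hdeg.le, hz2, hz3, hz4.trans (le_of_eq ?_)⟩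
      rw [hcard]
      norm_num
  · have := exists_zero_of_three_le hdeg hM3 hn hn'
      ((hsum n hn).trans (hsum n' hn').symm) hdist
    rwa [hcard, hdeg] at this
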